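/- Let $T$ be a complete (consistent) first-order theory in the language $\{\in\}$ of set theory that extends $\mathrm{ZF}$. An element $a$ of a structure $M$ is \emph{definable} in $M$ if $\{a\}=\{b\in M : M\models\varphi[b]\}$ for some first-order formula $\varphi$ without parameters, and \emph{algebraic} in $M$ if $a$ belongs to a finite set of the form $\{b\in M : M\models\varphi[b]\}$ with $\varphi$ a first-order formula without parameters; $M$ is \emph{(pointwise) algebraic} if every element of $M$ is algebraic in $M$. Then $T$ has an algebraic model if and only if $T$ has, up to isomorphism, a unique model in which each ordinal is definable (that is, there is a model $M$ of $T$ such that every $x\in M$ with $M\models$ ``$x$ is an ordinal'' is definable in $M$, and any two such models are isomorphic). -/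

import Mathlib

open FirstOrder FirstOrder.Language

universe u

namespace AlgSet

/-- The non-logical symbols of the language of set theory: one binary relation symbol. -/
inductive MemRel : ℕ → Type
  | mem : MemRel 2

/-- The language of set theory: the binary relation symbol `∈` (and logical equality). -/
def LSet : Language := ⟨fun _ => Empty, MemRel⟩

/-- The membership symbol. -/
def memSym : LSet.Relations 2 := MemRel.mem

/-- The atomic formula `t ∈ s`. -/
def mem {α : Type} {n : ℕ} (t s : LSet.Term (α ⊕ Fin n)) : LSet.BoundedFormula α n :=
  memSym.boundedFormula₂ t s

/-- The universal closure of a formula in the free variables `p₀, …, pₙ₋₁`. -/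
noncomputable def univClosure {n : ℕ} (ψ : LSet.Formula (Fin n)) : LSet.Sentence :=
  Formula.iAlls (Fin n) (ψ.relabel (Sum.inr : Fin n → Empty ⊕ Fin n))

/-- `φ(p, v₀, …, vₖ₋₁)` with the bound variables `&(i 0), …, &(i (k-1))` put for
`v₀, …, vₖ₋₁`. -/
def plug {n k m : ℕ} (φ : LSet.Formula (Fin n ⊕ Fin k)) (i : Fin k → Fin m) :
    LSet.BoundedFormula (Fin n) m :=
  BoundedFormula.relabel (n := m) (k := 0) (Sum.map id i) φ

/-- Extensionality: `∀ x y, (∀ z, z ∈ x ↔ z ∈ y) → x = y`. -/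
def extensionality : LSet.Sentence :=
  ∀' ∀' ((∀' (mem (&2) (&0) ⇔ mem (&2) (&1))) ⟹ (&0 =' &1))

/-- Foundation: `∀ x, (∃ y, y ∈ x) → ∃ y, y ∈ x ∧ ¬ ∃ z, z ∈ x ∧ z ∈ y`. -/
def foundation : LSet.Sentence :=
  ∀' ((∃' mem (&1) (&0)) ⟹
    ∃' (mem (&1) (&0) ⊓ ∼(∃' (mem (&2) (&0) ⊓ mem (&2) (&1)))))

/-- Pairing: `∀ x y, ∃ w, ∀ z, z ∈ w ↔ z = x ∨ z = y`. -/
def pairing : LSet.Sentence :=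
  ∀' ∀' ∃' ∀' (mem (&3) (&2) ⇔ ((&3 =' &0) ⊔ (&3 =' &1)))

/-- Union: `∀ x, ∃ w, ∀ z, z ∈ w ↔ ∃ y, y ∈ x ∧ z ∈ y`. -/
def union : LSet.Sentence :=
  ∀' ∃' ∀' (mem (&2) (&1) ⇔ ∃' (mem (&3) (&0) ⊓ mem (&2) (&3)))

/-- Power set: `∀ x, ∃ w, ∀ z, z ∈ w ↔ ∀ y, y ∈ z → y ∈ x`. -/
def powerset : LSet.Sentence :=
  ∀' ∃' ∀' (mem (&2) (&1) ⇔ ∀' (mem (&3) (&2) ⟹ mem (&3) (&0)))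

/-- Infinity: `∃ w, (∃ e, e ∈ w ∧ ∀ z, z ∉ e) ∧
  ∀ x, x ∈ w → ∃ y, y ∈ w ∧ ∀ z, z ∈ y ↔ z ∈ x ∨ z = x`. -/
def infinity : LSet.Sentence :=
  ∃' ((∃' (mem (&1) (&0) ⊓ ∀' ∼(mem (&2) (&1)))) ⊓
    ∀' (mem (&1) (&0) ⟹
      ∃' (mem (&2) (&0) ⊓ ∀' (mem (&3) (&2) ⇔ (mem (&3) (&1) ⊔ (&3 =' &1))))))

/-- Separation for `φ(p, x)`: `∀ p, ∀ a, ∃ b, ∀ x, x ∈ b ↔ x ∈ a ∧ φ(p, x)`. -/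
noncomputable def separation {n : ℕ} (φ : LSet.Formula (Fin n ⊕ Fin 1)) : LSet.Sentence :=
  univClosure (∀' ∃' ∀' (mem (&2) (&1) ⇔ (mem (&2) (&0) ⊓ plug φ ![(2 : Fin 3)])))

/-- Replacement for `φ(p, x, y)`: `∀ p, (∀ x y z, φ(p, x, y) ∧ φ(p, x, z) → y = z) →
  ∀ a, ∃ b, ∀ y, y ∈ b ↔ ∃ x, x ∈ a ∧ φ(p, x, y)`. -/
noncomputable def replacement {n : ℕ} (φ : LSet.Formula (Fin n ⊕ Fin 2)) : LSet.Sentence :=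
  univClosure
    ((∀' ∀' ∀' ((plug φ ![(0 : Fin 3), 1] ⊓ plug φ ![(0 : Fin 3), 2]) ⟹ (&1 =' &2))) ⟹
      ∀' ∃' ∀' (mem (&2) (&1) ⇔ ∃' (mem (&3) (&0) ⊓ plug φ ![(3 : Fin 4), 2])))

/-- The axioms of Zermelo–Fraenkel set theory `ZF`. -/
noncomputable def ZF : LSet.Theory :=
  {extensionality, foundation, pairing, union, powerset, infinity} ∪
    {σ | ∃ (n : ℕ) (φ : LSet.Formula (Fin n ⊕ Fin 1)), σ = separation φ} ∪
    {σ | ∃ (n : ℕ) (φ : LSet.Formula (Fin n ⊕ Fin 2)), σ = replacement φ}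

/-- `T` is an extension of `ZF`: every axiom of `ZF` is a consequence of `T`. -/
def ExtendsZF (T : LSet.Theory) : Prop := ∀ σ ∈ ZF, T ⊨ᵇ σ

section Models

variable (M : Type u) [LSet.Structure M]

variable {M} in
/-- The membership relation of the structure `M`. -/
def E (x y : M) : Prop := Structure.RelMap memSym ![x, y]

variable {M} in
/-- `a` is definable in `M`, without parameters. -/
def IsDefinableElement (a : M) : Prop := (∅ : Set M).Definable₁ LSet {a}

variable {M} in
/-- `a` is algebraic in `M`: it belongs to a finite set definable without parameters. -/
def IsAlgebraicElement (a : M) : Prop :=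
  ∃ s : Set M, (∅ : Set M).Definable₁ LSet s ∧ s.Finite ∧ a ∈ s

/-- `M` is (pointwise) algebraic: each of its elements is algebraic in it. -/
def PointwiseAlgebraic : Prop := ∀ a : M, IsAlgebraicElement a

variable {M} in
/-- `x` is an ordinal in the sense of `M`: a transitive set that is, in `M`, strictly
well-ordered by membership. -/
def IsOrdinalIn (x : M) : Prop :=
  (∀ y, E y x → ∀ z, E z y → E z x) ∧
  (∀ y, E y x → ¬ E y y) ∧
  (∀ y, E y x → ∀ z, E z x → ∀ w, E w x → E y z → E z w → E y w) ∧
  (∀ y, E y x → ∀ z, E z x → E y z ∨ y = z ∨ E z y) ∧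
  (∀ s : M, (∀ y, E y s → E y x) → (∃ y, E y s) →
    ∃ m, E m s ∧ ∀ y, E y s → m = y ∨ E m y)

/-- Each ordinal of `M` is definable in `M`, without parameters. -/
def OrdinalsDefinable : Prop := ∀ x : M, IsOrdinalIn x → IsDefinableElement x

end Models

end AlgSet

/-! Every model `M` of ZF has a parameter-free definable function `e` on its ordinals whose values
include all definable elements (`exists_enumeration_of_definable`). If the ordinals of `M` are
definable, then so is every value of `e`, so `ordinalRange e` is exactly the set of definable
elements. If this is not all of `M`, foundation for classes gives an `x` outside it all of whose
elements are inside. By extensionality such an `x` is told apart from any other element by a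
definable property (`exists_dfn_separating`).

Let `M` be algebraic. Its ordinals are definable, since a finite definable set of ordinals can be
listed in increasing order. A minimal `x` as above lies in a finite definable set, and finitely many
separating properties single it out, so it is definable: a contradiction. Hence `M` satisfies the
sentence that `e` enumerates everything. By completeness every model of `T` does, so each model with
definable ordinals is pointwise definable, and elementarily equivalent pointwise definable
structures are isomorphic (`nonempty_equiv_of_definable`).

Conversely, let `M` be the only model with definable ordinals, and suppose that a minimal `x` as
above exists. The type of `x` is not isolated, because an isolating formula would define `x`. The
type of an undefinable ordinal is not isolated either, because the least ordinal satisfying a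
formula is definable. Omitting both types (`exists_elementarilyEquivalent_omitting`) yields a model
with definable ordinals that is not isomorphic to `M`. So `M` is even pointwise definable.

The enumeration replaces ordinal definability: the levels of the cumulative hierarchy are closed
under a few set operations that evaluate formulas, and the closure is enumerated by recursion on
ordinals. The induction on formulas (`exists_satisfying`) takes place outside `M`, so neither coded
formulas nor the reflection principle is needed. -/

namespace AlgSet

/-! ### Calculus of definable predicates and functions, driven by instance search -/

section Definability

variable {M : Type u} [LSet.Structure M] {A : Set M} {α β : Type}

/-- `P` is first-order definable with parameters in `A`. -/
class Dfn (A : Set M) (P : (α → M) → Prop) : Prop where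
  out : ∃ φ : LSet.Formula (α ⊕ A), ∀ v, P v ↔ φ.Realize (Sum.elim v (fun a => (a : M)))

/-- The graph of `f` is first-order definable with parameters in `A`. -/
class DF (A : Set M) (f : (α → M) → M) : Prop where
  out : Dfn A (fun w : Option α → M => w none = f (fun a => w (some a)))

theorem Dfn.congr {P Q : (α → M) → Prop} (h : Dfn A P) (hPQ : ∀ v, P v ↔ Q v) : Dfn A Q := by
  obtain ⟨φ, hφ⟩ := h.out
  exact ⟨φ, fun v => (hPQ v).symm.trans (hφ v)⟩

theorem Dfn.reindex {P : (β → M) → Prop} (h : Dfn A P) (g : β → α) :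
    Dfn A (fun v : α → M => P (fun b => v (g b))) := by
  obtain ⟨φ, hφ⟩ := h.out
  refine ⟨φ.relabel (Sum.map g id), fun v => ?_⟩
  rw [hφ, Formula.realize_relabel]
  apply iff_of_eq; congr 1
  ext (i | i) <;> rfl

theorem Dfn.mono {P : (α → M) → Prop} {B : Set M} (h : Dfn A P) (hAB : A ⊆ B) : Dfn B P := by
  obtain ⟨φ, hφ⟩ := h.out
  refine ⟨φ.relabel (Sum.map id (Set.inclusion hAB)), fun v => ?_⟩
  rw [hφ, Formula.realize_relabel]
  apply iff_of_eq; congr 1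
  ext (i | i) <;> rfl

theorem Dfn.of_formula (φ : LSet.Formula α) : Dfn A (fun v : α → M => φ.Realize v) := by
  refine ⟨φ.relabel Sum.inl, fun v => ?_⟩
  rw [Formula.realize_relabel]; rfl

theorem Dfn.exists_formula {P : (α → M) → Prop} (h : Dfn (∅ : Set M) P) :
    ∃ φ : LSet.Formula α, ∀ v, P v ↔ φ.Realize v := by
  obtain ⟨φ, hφ⟩ := h.out
  refine ⟨φ.relabel (Sum.elim id (fun a => a.2.elim)), fun v => ?_⟩
  rw [hφ, Formula.realize_relabel]
  apply iff_of_eq; congr 1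
  ext (i | i)
  · rfl
  · exact i.2.elim

instance Dfn.not {P : (α → M) → Prop} [h : Dfn A P] : Dfn A (fun v => ¬ P v) := by
  obtain ⟨φ, hφ⟩ := h.out
  exact ⟨φ.not, fun v => by rw [Formula.realize_not, hφ]⟩

instance Dfn.imp {P Q : (α → M) → Prop} [h : Dfn A P] [h' : Dfn A Q] :
    Dfn A (fun v => P v → Q v) := by
  obtain ⟨φ, hφ⟩ := h.out
  obtain ⟨ψ, hψ⟩ := h'.out
  exact ⟨φ.imp ψ, fun v => by rw [Formula.realize_imp, hφ, hψ]⟩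

instance Dfn.and {P Q : (α → M) → Prop} [Dfn A P] [Dfn A Q] : Dfn A (fun v => P v ∧ Q v) :=
  Dfn.congr (P := fun v => ¬ (P v → ¬ Q v)) inferInstance fun v => by tauto

instance Dfn.or {P Q : (α → M) → Prop} [Dfn A P] [Dfn A Q] : Dfn A (fun v => P v ∨ Q v) :=
  Dfn.congr (P := fun v => ¬ P v → Q v) inferInstance fun v => by tauto

instance Dfn.iff {P Q : (α → M) → Prop} [Dfn A P] [Dfn A Q] : Dfn A (fun v => P v ↔ Q v) :=
  Dfn.congr (P := fun v => (P v → Q v) ∧ (Q v → P v)) inferInstance fun v => by tauto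

theorem Dfn.exists_of_finite {γ : Type} [Finite γ] {Q : (α → M) → (γ → M) → Prop}
    (h : Dfn A (fun w : α ⊕ γ → M => Q (fun a => w (Sum.inl a)) (fun b => w (Sum.inr b)))) :
    Dfn A (fun v => ∃ x, Q v x) := by
  obtain ⟨φ, hφ⟩ := h.out
  refine ⟨(φ.relabel (fun i : (α ⊕ γ) ⊕ A =>
    (Sum.elim (Sum.elim (fun a => Sum.inl (Sum.inl a)) Sum.inr) (fun a => Sum.inl (Sum.inr a)) i :
      (α ⊕ A) ⊕ γ))).iExs γ, fun v => ?_⟩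
  rw [Formula.realize_iExs]
  refine exists_congr fun x => ?_
  rw [Formula.realize_relabel]
  refine (hφ (Sum.elim v x)).trans ?_
  apply iff_of_eq; congr 1
  ext ((i | i) | i) <;> rfl

/-- The fresh variable is `none`. In this form the predicate may be an ordinary Lean proposition,
which instance search takes apart connective by connective. -/
instance Dfn.ex {Q : (α → M) → M → Prop}
    [h : Dfn A (fun w : Option α → M => Q (fun a => w (some a)) (w none))] :
    Dfn A (fun v => ∃ x, Q v x) :=
  Dfn.congr (Dfn.exists_of_finite (γ := Unit) (Q := fun v x => Q v (x ()))
    (h.reindex (fun o : Option α => o.elim (Sum.inr ()) Sum.inl))) fun _ =>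
      ⟨fun ⟨x, hx⟩ => ⟨x (), hx⟩, fun ⟨x, hx⟩ => ⟨fun _ => x, hx⟩⟩

instance Dfn.all {Q : (α → M) → M → Prop}
    [Dfn A (fun w : Option α → M => Q (fun a => w (some a)) (w none))] :
    Dfn A (fun v => ∀ x, Q v x) :=
  Dfn.congr (P := fun v => ¬ ∃ x, ¬ Q v x) inferInstance fun _ => by push Not; rfl

theorem Dfn.forall_of_finite {ι : Type*} [Finite ι] {P : ι → (α → M) → Prop}
    (h : ∀ i, Dfn A (P i)) : Dfn A (fun v => ∀ i, P i v) := by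
  choose φ hφ using fun i => (h i).out
  refine ⟨Formula.iInf φ, fun v => ?_⟩
  rw [Formula.realize_iInf]
  exact forall_congr' fun i => hφ i v

theorem Dfn.mem_var (i j : α) : Dfn A (fun v => E (v i) (v j)) := by
  refine ⟨memSym.formula₂ (.var (.inl i)) (.var (.inl j)), fun v => ?_⟩
  rw [Formula.realize_rel₂]; rfl

theorem Dfn.eq_var (i j : α) : Dfn A (fun v => v i = v j) := by
  refine ⟨Term.equal (.var (.inl i)) (.var (.inl j)), fun v => ?_⟩
  rw [Formula.realize_equal]; rfl

instance DF.var (i : α) : DF A (fun v => v i) := ⟨Dfn.eq_var _ _⟩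

theorem DF.const_of_mem {c : M} (hc : c ∈ A) : DF A (fun _ : α → M => c) := by
  refine ⟨⟨Term.equal (.var (.inl none)) (.var (.inr ⟨c, hc⟩)), fun v => ?_⟩⟩
  rw [Formula.realize_equal]; rfl

instance DF.const {c : M} : DF Set.univ (fun _ : α → M => c) := DF.const_of_mem trivial

theorem DF.mono {f : (α → M) → M} {B : Set M} (h : DF A f) (hAB : A ⊆ B) : DF B f :=
  ⟨h.out.mono hAB⟩

/-- The functions are known only through their graphs, so substitution is expressed by quantifying
over the tuple of values. -/
theorem Dfn.comp {ι : Type} [Finite ι] {R : (ι → M) → Prop} (hR : Dfn A R)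
    {f : ι → (α → M) → M} (hf : ∀ i, DF A (f i)) : Dfn A (fun v => R (fun i => f i v)) := by
  refine Dfn.congr (P := fun v => ∃ x : ι → M, (∀ i, x i = f i v) ∧ R x) ?_ fun v => ?_
  · apply Dfn.exists_of_finite (Q := fun v (x : ι → M) => (∀ i, x i = f i v) ∧ R x)
    have h1 : Dfn A fun w : α ⊕ ι → M => ∀ i, w (Sum.inr i) = f i fun a => w (Sum.inl a) := by
      refine Dfn.forall_of_finite (P := fun i (w : α ⊕ ι → M) => w (Sum.inr i) =
        f i fun a => w (Sum.inl a)) fun i => ?_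
      exact (hf i).out.reindex (fun o : Option α => o.elim (Sum.inr i) Sum.inl)
    have h2 : Dfn A fun w : α ⊕ ι → M => R fun b => w (Sum.inr b) := hR.reindex Sum.inr
    exact Dfn.and
  · constructor
    · rintro ⟨x, hx, h⟩
      rwa [← funext hx]
    · exact fun h => ⟨_, fun _ => rfl, h⟩

theorem Dfn.comp1 {R : M → Prop} (hR : Dfn A (fun v : Fin 1 → M => R (v 0)))
    {f : (α → M) → M} (hf : DF A f) : Dfn A (fun v => R (f v)) :=
  Dfn.comp hR (f := fun _ => f) (fun _ => hf)

theorem Dfn.comp2 {R : M → M → Prop} (hR : Dfn A (fun v : Fin 2 → M => R (v 0) (v 1)))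
    {f g : (α → M) → M} (hf : DF A f) (hg : DF A g) : Dfn A (fun v => R (f v) (g v)) :=
  Dfn.comp hR (f := ![f, g]) (by intro i; fin_cases i <;> assumption)

instance Dfn.mem {f g : (α → M) → M} [hf : DF A f] [hg : DF A g] :
    Dfn A (fun v => E (f v) (g v)) := Dfn.comp2 (Dfn.mem_var 0 1) hf hg

instance Dfn.eq {f g : (α → M) → M} [hf : DF A f] [hg : DF A g] :
    Dfn A (fun v => f v = g v) := Dfn.comp2 (R := fun x y => x = y) (Dfn.eq_var 0 1) hf hg

theorem DF.comp {ι : Type} [Finite ι] {F : (ι → M) → M} (hF : DF A F)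
    {f : ι → (α → M) → M} (hf : ∀ i, DF A (f i)) : DF A (fun v => F (fun i => f i v)) := by
  refine ⟨Dfn.comp hF.out (f := fun o w => o.elim (w none) (fun i => f i (fun a => w (some a))))
    fun o => ?_⟩
  cases o with
  | none => exact DF.var none
  | some i =>
    exact ⟨(hf i).out.reindex (fun o => o.elim none (fun a => some (some a)))⟩

theorem DF.comp1 {F : M → M} (hF : DF A (fun v : Fin 1 → M => F (v 0)))
    {f : (α → M) → M} (hf : DF A f) : DF A (fun v => F (f v)) :=
  DF.comp hF (f := fun _ => f) (fun _ => hf)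

theorem DF.comp2 {F : M → M → M} (hF : DF A (fun v : Fin 2 → M => F (v 0) (v 1)))
    {f g : (α → M) → M} (hf : DF A f) (hg : DF A g) : DF A (fun v => F (f v) (g v)) :=
  DF.comp hF (f := ![f, g]) (by intro i; fin_cases i <;> assumption)

theorem DF.comp5 {F : M → M → M → M → M → M}
    (hF : DF A (fun v : Fin 5 → M => F (v 0) (v 1) (v 2) (v 3) (v 4)))
    {f g h k l : (α → M) → M} (hf : DF A f) (hg : DF A g) (hh : DF A h) (hk : DF A k)
    (hl : DF A l) : DF A (fun v => F (f v) (g v) (h v) (k v) (l v)) :=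
  DF.comp hF (f := ![f, g, h, k, l]) (by intro i; fin_cases i <;> assumption)

instance Dfn.isOrdinalIn {f : (α → M) → M} [hf : DF A f] : Dfn A (fun v => IsOrdinalIn (f v)) :=
  Dfn.comp1 (by unfold IsOrdinalIn; infer_instance) hf

end Definability

/-! ### From the axioms as sentences to their semantic form -/

/-- The axioms of `ZF`, stated for a structure `M` in terms of its definable classes. -/
class ZFModel (M : Type u) [LSet.Structure M] : Prop where
  nonempty : Nonempty M
  ext : ∀ x y : M, (∀ z, E z x ↔ E z y) → x = y
  found : ∀ x : M, (∃ y, E y x) → ∃ y, E y x ∧ ¬ ∃ z, E z x ∧ E z y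
  pair : ∀ x y : M, ∃ w, ∀ z, E z w ↔ z = x ∨ z = y
  union : ∀ x : M, ∃ w, ∀ z, E z w ↔ ∃ y, E y x ∧ E z y
  pow : ∀ x : M, ∃ w, ∀ z, E z w ↔ ∀ y, E y z → E y x
  inf : ∃ w : M, (∃ e, E e w ∧ ∀ z, ¬ E z e) ∧
    ∀ x, E x w → ∃ y, E y w ∧ ∀ z, E z y ↔ E z x ∨ z = x
  sep' : ∀ P : M → Prop, Dfn Set.univ (fun v : Fin 1 → M => P (v 0)) →
    ∀ a, ∃ b, ∀ x, E x b ↔ E x a ∧ P x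
  repl' : ∀ R : M → M → Prop, Dfn Set.univ (fun v : Fin 2 → M => R (v 0) (v 1)) →
    (∀ x y z, R x y ∧ R x z → y = z) → ∀ a, ∃ b, ∀ y, E y b ↔ ∃ x, E x a ∧ R x y

section

variable {M : Type u} [LSet.Structure M]

/-- A formula has finitely many free variables, so finitely many parameters suffice, as the axiom
schemes require. -/
theorem Dfn.exists_formula_parameters [Nonempty M] {α : Type} {P : (α → M) → Prop}
    (h : Dfn Set.univ P) : ∃ (n : ℕ) (φ : LSet.Formula (Fin n ⊕ α)) (p : Fin n → M),
      ∀ v, P v ↔ φ.Realize (Sum.elim p v) := by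
  classical
  obtain ⟨φ, hφ⟩ := h.out
  let e := φ.freeVarFinset.equivFin
  let f : φ.freeVarFinset → Fin φ.freeVarFinset.card ⊕ α :=
    fun s => Sum.elim (fun i => Sum.inr i) (fun _ => Sum.inl (e s)) s.1
  refine ⟨_, φ.restrictFreeVar f,
    -- Indices that come from genuine variables receive a dummy parameter, which the formula never
    -- mentions.
    fun j => Sum.elim (fun _ => Classical.arbitrary M) (fun a => a.1) (e.symm j).1, fun v => ?_⟩
  rw [hφ]
  refine (BoundedFormula.realize_restrictFreeVar _ ?_).symm
  rintro ⟨i | i, hi⟩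
  · rfl
  · simp [f]

@[simp] theorem realize_mem {α : Type} {n : ℕ} (t s : LSet.Term (α ⊕ Fin n)) (v : α → M)
    (xs : Fin n → M) : (mem t s).Realize v xs ↔
      E (t.realize (Sum.elim v xs)) (s.realize (Sum.elim v xs)) := by
  simp [mem, E, BoundedFormula.realize_rel₂]

theorem realize_univClosure {n : ℕ} (ψ : LSet.Formula (Fin n)) :
    M ⊨ univClosure ψ ↔ ∀ p : Fin n → M, ψ.Realize p := by
  unfold univClosure Sentence.Realize
  rw [Formula.realize_iAlls]
  refine forall_congr' fun p => ?_
  rw [Formula.realize_relabel]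
  rfl

theorem realize_plug {n k m : ℕ} (φ : LSet.Formula (Fin n ⊕ Fin k)) (i : Fin k → Fin m)
    (p : Fin n → M) (xs : Fin m → M) :
    (plug φ i).Realize p xs ↔ φ.Realize (Sum.elim p (xs ∘ i)) := by
  unfold plug Formula.Realize
  refine BoundedFormula.realize_relabel.trans (iff_of_eq ?_)
  congr 1
  · ext (j | j) <;> rfl
  · exact Subsingleton.elim _ _

theorem ZFModel.of_realize [Nonempty M] (h : ∀ σ ∈ ZF, M ⊨ σ) : ZFModel M where
  nonempty := inferInstance
  ext := by
    have := h AlgSet.extensionality (by simp [ZF])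
    simpa [extensionality, Sentence.Realize, Formula.Realize, Fin.snoc] using this
  found := by
    have := h foundation (by simp [ZF])
    simpa [foundation, Sentence.Realize, Formula.Realize, Fin.snoc] using this
  pair := by
    have := h pairing (by simp [ZF])
    simpa [pairing, Sentence.Realize, Formula.Realize, Fin.snoc] using this
  union := by
    have := h AlgSet.union (by simp [ZF])
    simpa [AlgSet.union, Sentence.Realize, Formula.Realize, Fin.snoc] using this
  pow := by
    have := h powerset (by simp [ZF])
    simpa [powerset, Sentence.Realize, Formula.Realize, Fin.snoc] using this
  inf := by
    have := h infinity (by simp [ZF])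
    simpa [infinity, Sentence.Realize, Formula.Realize, Fin.snoc] using this
  sep' := by
    intro P hP
    obtain ⟨n, φ, p, hp⟩ := hP.exists_formula_parameters
    have := (realize_univClosure _).1 (h (separation φ) (Or.inl (Or.inr ⟨n, φ, rfl⟩))) p
    simp only [Formula.Realize, BoundedFormula.realize_all, BoundedFormula.realize_ex,
      BoundedFormula.realize_iff, BoundedFormula.realize_inf, realize_mem, realize_plug] at this
    intro a
    obtain ⟨b, hb⟩ := this a
    refine ⟨b, fun x => (hb x).trans (and_congr Iff.rfl ?_)⟩
    rw [hp fun _ => x]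
    apply iff_of_eq
    change BoundedFormula.Realize _ _ _ = BoundedFormula.Realize _ _ _
    congr 2
    ext i; fin_cases i; rfl
  repl' := by
    intro R hR
    obtain ⟨n, φ, p, hp⟩ := hR.exists_formula_parameters
    have := (realize_univClosure _).1 (h (replacement φ) (Or.inr ⟨n, φ, rfl⟩)) p
    simp only [Formula.Realize, BoundedFormula.realize_all, BoundedFormula.realize_ex,
      BoundedFormula.realize_iff, BoundedFormula.realize_inf, realize_mem, realize_plug,
      BoundedFormula.realize_imp] at this
    have key : ∀ x y, R x y ↔ φ.Realize (Sum.elim p ![x, y]) := fun x y => hp ![x, y]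
    intro hf a
    have key' : ∀ {m} (xs : Fin m → M) (i j : Fin m),
        BoundedFormula.Realize φ (Sum.elim p (xs ∘ ![i, j])) default ↔ R (xs i) (xs j) := by
      intro m xs i j
      rw [key]
      apply iff_of_eq
      change BoundedFormula.Realize _ _ _ = BoundedFormula.Realize _ _ _
      congr 2
      ext k; fin_cases k <;> rfl
    simp only [key'] at this
    obtain ⟨b, hb⟩ := this (fun x y z hxyz => hf x y z hxyz) a
    exact ⟨b, hb⟩

end

/-! ### Definite descriptions and set comprehension -/

section The

variable {M : Type u} [LSet.Structure M] [ZFModel M] {A : Set M} {α : Type}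

instance ZFModel.instNonempty : Nonempty M := ZFModel.nonempty

theorem ext {x y : M} (h : ∀ z, E z x ↔ E z y) : x = y := ZFModel.ext x y h

/-- The empty set of `M`. -/
noncomputable def emp : M := Classical.epsilon fun y => ∀ z, ¬ E z y

theorem not_mem_emp (z : M) : ¬ E z emp := by
  have : ∃ y : M, ∀ z, ¬ E z y := by
    obtain ⟨w, ⟨e, -, he⟩, -⟩ := ZFModel.inf (M := M)
    exact ⟨e, he⟩
  exact Classical.epsilon_spec this z

theorem eq_emp {x : M} : x = emp ↔ ∀ z, ¬ E z x :=
  ⟨fun h => h ▸ not_mem_emp, fun h => ext fun z => by simp [h z, not_mem_emp z]⟩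

instance DF.emp : DF A (fun _ : α → M => emp) :=
  ⟨Dfn.congr (P := fun w : Option α → M => ∀ z, ¬ E z (w none)) inferInstance
    fun _ => eq_emp.symm⟩

open Classical in
/-- The unique element of `M` with the property `P`, and the empty set if there is none. -/
noncomputable def the (P : M → Prop) : M := if h : ∃! x, P x then h.choose else emp

theorem the_eq {P : M → Prop} {x : M} (hx : P x) (h : ∀ y, P y → y = x) : the P = x := by
  have hP : ∃! x, P x := ⟨x, hx, h⟩
  rw [the, dif_pos hP]
  exact h _ hP.choose_spec.1

theorem the_spec {P : M → Prop} (h : ∃! x, P x) : P (the P) := by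
  rw [the, dif_pos h]; exact h.choose_spec.1

instance DF.the {P : (α → M) → M → Prop}
    [Dfn A (fun w : Option α → M => P (fun a => w (some a)) (w none))] :
    DF A (fun v => the (P v)) := by
  have h1 : Dfn A (fun v : α → M => ∃ x, P v x ∧ ∀ y, P v y → y = x) := by
    -- `P` about the second candidate `y`, with the variable of the first candidate `x` skipped.
    have : Dfn A (fun w : Option (Option α) → M =>
        P (fun a => w (some (some a))) (w none)) :=
      Dfn.reindex (P := fun w : Option α → M => P (fun a => w (some a)) (w none)) inferInstance
        (fun o : Option α => o.elim none (fun a => some (some a)))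
    infer_instance
  have h2 : Dfn A (fun w : Option α → M =>
      ∃ x, P (fun a => w (some a)) x ∧ ∀ y, P (fun a => w (some a)) y → y = x) :=
    h1.reindex some
  refine ⟨Dfn.congr (P := fun w : Option α → M =>
    (P (fun a => w (some a)) (w none) ∧
      ∃ x, P (fun a => w (some a)) x ∧ ∀ y, P (fun a => w (some a)) y → y = x) ∨
    (¬ (∃ x, P (fun a => w (some a)) x ∧ ∀ y, P (fun a => w (some a)) y → y = x) ∧
      w none = AlgSet.emp)) inferInstance fun w => ?_⟩
  by_cases h : ∃! x, P (fun a => w (some a)) x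
  · have h' : ∃ x, P (fun a => w (some a)) x ∧ ∀ y, P (fun a => w (some a)) y → y = x := h
    constructor
    · rintro (⟨h3, -⟩ | ⟨h3, -⟩)
      · exact h.unique h3 (the_spec h)
      · exact absurd h' h3
    · intro h3
      exact Or.inl ⟨h3 ▸ the_spec h, h'⟩
  · have h' : ¬ ∃ x, P (fun a => w (some a)) x ∧ ∀ y, P (fun a => w (some a)) y → y = x := h
    simp only [h', AlgSet.the, dif_neg h, and_false, false_or, not_false_eq_true, true_and]

/-- The class `P` is a set. -/
def IsSet (P : M → Prop) : Prop := ∃ y, ∀ z, E z y ↔ P z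

/-- The set of all elements of `M` with the property `P`, if the class `P` is a set. -/
noncomputable def toSet (P : M → Prop) : M := the fun y => ∀ z, E z y ↔ P z

theorem IsSet.mem_toSet {P : M → Prop} (h : IsSet P) {z : M} : E z (toSet P) ↔ P z := by
  obtain ⟨y, hy⟩ := h
  have : toSet P = y := the_eq hy fun x hx => ext fun z => (hx z).trans (hy z).symm
  rw [this, hy]

instance DF.toSet {P : (α → M) → M → Prop}
    [Dfn A (fun w : Option α → M => P (fun a => w (some a)) (w none))] :
    DF A (fun v => toSet (P v)) := by
  have : Dfn A (fun w : Option (Option α) → M =>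
      P (fun a => w (some (some a))) (w none)) :=
    Dfn.reindex (P := fun w : Option α → M => P (fun a => w (some a)) (w none)) inferInstance
      (fun o : Option α => o.elim none (fun a => some (some a)))
  unfold AlgSet.toSet
  infer_instance

open Classical in
instance DF.ite {c : (α → M) → Prop} {f g : (α → M) → M} [hc : Dfn A c] [hf : DF A f]
    [hg : DF A g] : DF A (fun v => if c v then f v else g v) := by
  refine ⟨?_⟩
  have h1 := hf.out
  have h2 := hg.out
  have h3 : Dfn A (fun w : Option α → M => c (fun a => w (some a))) := hc.reindex some
  refine Dfn.congr (P := fun w : Option α → M => (c (fun a => w (some a)) →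
    w none = f (fun a => w (some a))) ∧ (¬ c (fun a => w (some a)) →
    w none = g (fun a => w (some a)))) inferInstance fun w => ?_
  by_cases h : c (fun a => w (some a)) <;> simp [h]

theorem IsSet.sep (a : M) (P : M → Prop) [h : Dfn Set.univ (fun v : Fin 1 → M => P (v 0))] :
    IsSet fun z => E z a ∧ P z := ZFModel.sep' P h a

theorem IsSet.image (a : M) (F : M → M) [h : DF Set.univ (fun v : Fin 1 → M => F (v 0))] :
    IsSet fun z => ∃ x, E x a ∧ z = F x := by
  obtain ⟨b, hb⟩ := ZFModel.repl' (fun x y => y = F x)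
    (h.out.reindex (fun o : Option (Fin 1) => o.elim 1 (fun _ => 0)))
    (fun x y z h => h.1.trans h.2.symm) a
  exact ⟨b, hb⟩

theorem IsSet.of_subset {P : M → Prop} {a : M} (h : ∀ z, P z → E z a)
    (hP : Dfn Set.univ (fun v : Fin 1 → M => P (v 0))) : IsSet P := by
  obtain ⟨y, hy⟩ := IsSet.sep a P
  exact ⟨y, fun z => (hy z).trans ⟨fun h => h.2, fun hz => ⟨h z hz, hz⟩⟩⟩

end The

/-! ### Elementary set operations -/

section Sets

variable {M : Type u} [LSet.Structure M] [ZFModel M] {A : Set M} {α : Type}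

/-- The unordered pair of two elements of `M`. -/
noncomputable def upair (a b : M) : M := toSet fun z => z = a ∨ z = b

theorem mem_upair {a b z : M} : E z (upair a b) ↔ z = a ∨ z = b :=
  IsSet.mem_toSet (ZFModel.pair a b)

instance DF.upair {f g : (α → M) → M} [hf : DF A f] [hg : DF A g] :
    DF A (fun v => upair (f v) (g v)) := DF.comp2 (by unfold AlgSet.upair; infer_instance) hf hg

/-- The Kuratowski ordered pair of two elements of `M`. -/
noncomputable def opair (a b : M) : M := upair (upair a a) (upair a b)

instance DF.opair {f g : (α → M) → M} [hf : DF A f] [hg : DF A g] :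
    DF A (fun v => opair (f v) (g v)) := DF.comp2 (by unfold AlgSet.opair; infer_instance) hf hg

theorem upair_inj {a b c : M} (h : upair a b = upair a c) : b = c := by
  have h1 : b = a ∨ b = c := mem_upair.1 (h ▸ mem_upair.2 (Or.inr rfl))
  have h2 : c = a ∨ c = b := mem_upair.1 (h ▸ mem_upair.2 (Or.inr rfl))
  grind

theorem opair_inj {a b c d : M} : opair a b = opair c d ↔ a = c ∧ b = d := by
  constructor
  · intro h
    have h1 : upair a a = upair c c ∨ upair a a = upair c d :=
      mem_upair.1 (show E (upair a a) (opair c d) from h ▸ mem_upair.2 (Or.inl rfl))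
    have hc : c = a := by
      rcases h1 with h1 | h1
      · have : E c (upair a a) := h1 ▸ mem_upair.2 (Or.inl rfl)
        simpa using mem_upair.1 this
      · have : E c (upair a a) := h1 ▸ mem_upair.2 (Or.inl rfl)
        simpa using mem_upair.1 this
    subst hc
    exact ⟨rfl, upair_inj (upair_inj h)⟩
  · rintro ⟨rfl, rfl⟩; rfl

/-- The union of an element of `M`. -/
noncomputable def sUnion (x : M) : M := toSet fun z => ∃ y, E y x ∧ E z y

theorem mem_sUnion {x z : M} : E z (sUnion x) ↔ ∃ y, E y x ∧ E z y :=
  IsSet.mem_toSet (ZFModel.union x)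

instance DF.sUnion {f : (α → M) → M} [hf : DF A f] : DF A (fun v => sUnion (f v)) :=
  DF.comp1 (by unfold AlgSet.sUnion; infer_instance) hf

theorem IsSet.biUnion (a : M) (F : M → M) [DF Set.univ (fun v : Fin 1 → M => F (v 0))] :
    IsSet fun z => ∃ x, E x a ∧ E z (F x) := by
  obtain ⟨b, hb⟩ := IsSet.image a F
  refine ⟨sUnion b, fun z => mem_sUnion.trans ?_⟩
  constructor
  · rintro ⟨y, hy, hz⟩
    obtain ⟨x, hx, rfl⟩ := (hb y).1 hy
    exact ⟨x, hx, hz⟩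
  · rintro ⟨x, hx, hz⟩
    exact ⟨F x, (hb _).2 ⟨x, hx, rfl⟩, hz⟩

/-- The set `x ∪ {a}`. -/
noncomputable def ins (a x : M) : M := toSet fun z => E z x ∨ z = a

theorem mem_ins {a x z : M} : E z (ins a x) ↔ E z x ∨ z = a := by
  refine IsSet.mem_toSet ⟨sUnion (upair x (upair a a)), fun z => ?_⟩
  simp [mem_sUnion, mem_upair]

instance DF.ins {f g : (α → M) → M} [hf : DF A f] [hg : DF A g] :
    DF A (fun v => ins (f v) (g v)) := DF.comp2 (by unfold AlgSet.ins; infer_instance) hf hg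

/-- The inclusion relation of `M`. -/
def Sub (x y : M) : Prop := ∀ z, E z x → E z y

instance Dfn.sub {f g : (α → M) → M} [hf : DF A f] [hg : DF A g] :
    Dfn A (fun v => Sub (f v) (g v)) := Dfn.comp2 (by unfold AlgSet.Sub; infer_instance) hf hg

/-- The power set of an element of `M`. -/
noncomputable def pow (x : M) : M := toSet fun z => Sub z x

theorem mem_pow {x z : M} : E z (pow x) ↔ Sub z x := IsSet.mem_toSet (ZFModel.pow x)

instance DF.pow {f : (α → M) → M} [hf : DF A f] : DF A (fun v => pow (f v)) :=
  DF.comp1 (by unfold AlgSet.pow; infer_instance) hf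

theorem not_mem_self (x : M) : ¬ E x x := by
  intro h
  obtain ⟨y, hy, hmin⟩ := ZFModel.found (upair x x) ⟨x, mem_upair.2 (Or.inl rfl)⟩
  have : y = x := by simpa using mem_upair.1 hy
  subst this
  exact hmin ⟨y, hy, h⟩

end Sets

/-! ### Ordinals of the model -/

section Ordinals

section

variable {M : Type u} [LSet.Structure M]

theorem IsOrdinalIn.mem {x y : M} (hx : IsOrdinalIn x) (hy : E y x) : IsOrdinalIn y := by
  obtain ⟨h1, h2, h3, h4, h5⟩ := hx
  refine ⟨fun u hu z hz => h3 z (h1 u (h1 y hy u hu) z hz) u (h1 y hy u hu) y hy hz hu,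
    fun u hu => h2 u (h1 y hy u hu), ?_, ?_, ?_⟩
  · exact fun a ha b hb c hc => h3 a (h1 y hy a ha) b (h1 y hy b hb) c (h1 y hy c hc)
  · exact fun a ha b hb => h4 a (h1 y hy a ha) b (h1 y hy b hb)
  · exact fun s hs => h5 s fun a ha => h1 y hy a (hs a ha)

theorem IsOrdinalIn.trans {x y z : M} (hx : IsOrdinalIn x) (hz : E z y) (hy : E y x) : E z x :=
  hx.1 y hy z hz

end

variable {M : Type u} [LSet.Structure M] [ZFModel M] {A : Set M} {α : Type}

/-- The set `d` is the least element of `x` outside `d`. -/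
theorem IsOrdinalIn.mem_of_transitive {x d : M} (hx : IsOrdinalIn x) (hd : Sub d x)
    (htr : ∀ y, E y d → ∀ z, E z y → E z d) (hne : d ≠ x) : E d x := by
  obtain ⟨s, hs⟩ := IsSet.sep x (fun z => ¬ E z d)
  have hs0 : ∃ y, E y s := by
    by_contra! h
    refine hne (ext fun z => ⟨hd z, fun hz => ?_⟩)
    by_contra hzd
    exact h z ((hs z).2 ⟨hz, hzd⟩)
  obtain ⟨m, hm, hmin⟩ := hx.2.2.2.2 s (fun y hy => ((hs y).1 hy).1) hs0
  obtain ⟨hmx, hmd⟩ := (hs m).1 hm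
  have : d = m := by
    refine ext fun y => ⟨fun hy => ?_, fun hy => ?_⟩
    · rcases hx.2.2.2.1 y (hd y hy) m hmx with h | h | h
      · exact h
      · exact absurd (h ▸ hy) hmd
      · exact absurd (htr y hy m h) hmd
    · by_contra hyd
      have hyx := hx.trans hy hmx
      rcases hmin y ((hs y).2 ⟨hyx, hyd⟩) with h | h
      · exact not_mem_self m (h.symm ▸ hy)
      · exact not_mem_self m ((hx.mem hmx).trans h hy)
  exact this ▸ hmx

/-- The intersection is a transitive subset of both ordinals. Were it different from both, it would
belong to both, hence to itself. -/
theorem IsOrdinalIn.trichotomy {x y : M} (hx : IsOrdinalIn x) (hy : IsOrdinalIn y) :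
    E x y ∨ x = y ∨ E y x := by
  obtain ⟨d, hd⟩ := IsSet.sep x (fun z => E z y)
  have htr : ∀ u, E u d → ∀ z, E z u → E z d := fun u hu z hz =>
    (hd z).2 ⟨hx.trans hz ((hd u).1 hu).1, hy.trans hz ((hd u).1 hu).2⟩
  have h1 := hx.mem_of_transitive (fun z hz => ((hd z).1 hz).1) htr
  have h2 := hy.mem_of_transitive (fun z hz => ((hd z).1 hz).2) htr
  by_cases hdx : d = x
  · by_cases hdy : d = y
    · exact Or.inr (Or.inl (hdx.symm.trans hdy))
    · exact Or.inl (hdx ▸ h2 hdy)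
  · by_cases hdy : d = y
    · exact Or.inr (Or.inr (hdy ▸ h1 hdx))
    · exact absurd ((hd d).2 ⟨h1 hdx, h2 hdy⟩) (not_mem_self d)

theorem exists_least_ordinal (P : M → Prop) [Dfn Set.univ (fun v : Fin 1 → M => P (v 0))]
    {x : M} (hx : IsOrdinalIn x) (hP : P x) :
    ∃ m, IsOrdinalIn m ∧ P m ∧ ∀ y, E y m → ¬ P y := by
  by_cases h : ∃ y, E y x ∧ P y
  · obtain ⟨s, hs⟩ := IsSet.sep x P
    obtain ⟨y, hy⟩ := h
    obtain ⟨m, hm, hmin⟩ := hx.2.2.2.2 s (fun y hy => ((hs y).1 hy).1) ⟨y, (hs y).2 hy⟩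
    have hmx := ((hs m).1 hm).1
    refine ⟨m, hx.mem hmx, ((hs m).1 hm).2, fun z hz hPz => ?_⟩
    rcases hmin z ((hs z).2 ⟨hx.trans hz hmx, hPz⟩) with h | h
    · exact not_mem_self m (h.symm ▸ hz)
    · exact not_mem_self m ((hx.mem hmx).trans h hz)
  · push Not at h
    exact ⟨x, hx, hP, h⟩

theorem ordinal_induction (P : M → Prop) [Dfn Set.univ (fun v : Fin 1 → M => P (v 0))]
    (h : ∀ x, IsOrdinalIn x → (∀ y, E y x → P y) → P x) {x : M} (hx : IsOrdinalIn x) : P x := by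
  by_contra hPx
  obtain ⟨m, hm, hPm, hmin⟩ := exists_least_ordinal (fun y => ¬ P y) hx hPx
  exact hPm (h m hm fun y hy => not_not.1 (hmin y hy))

theorem isOrdinalIn_of_transitive {x : M} (h : ∀ y, E y x → IsOrdinalIn y)
    (htr : ∀ y, E y x → ∀ z, E z y → E z x) : IsOrdinalIn x := by
  refine ⟨htr, fun y _ => not_mem_self y, fun y _ z _ w hw hyz hzw => (h w hw).trans hyz hzw,
    fun y hy z hz => (h y hy).trichotomy (h z hz), fun s hs ⟨y, hy⟩ => ?_⟩
  obtain ⟨m, hm, hms, hmin⟩ := exists_least_ordinal (fun z => E z s) (h y (hs y hy)) hy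
  refine ⟨m, hms, fun z hz => ?_⟩
  rcases hm.trichotomy (h z (hs z hz)) with h1 | h1 | h1
  · exact Or.inr h1
  · exact Or.inl h1
  · exact absurd hz (hmin z h1)

theorem isOrdinalIn_sUnion {x : M} (h : ∀ y, E y x → IsOrdinalIn y) : IsOrdinalIn (sUnion x) := by
  refine isOrdinalIn_of_transitive (fun y hy => ?_) fun y hy z hz => ?_
  · obtain ⟨u, hu, hyu⟩ := mem_sUnion.1 hy
    exact (h u hu).mem hyu
  · obtain ⟨u, hu, hyu⟩ := mem_sUnion.1 hy
    exact mem_sUnion.2 ⟨u, hu, (h u hu).trans hz hyu⟩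

theorem IsOrdinalIn.succ {x : M} (h : IsOrdinalIn x) : IsOrdinalIn (ins x x) := by
  refine isOrdinalIn_of_transitive (fun y hy => ?_) fun y hy z hz => ?_
  · rcases mem_ins.1 hy with hy | rfl
    exacts [h.mem hy, h]
  · rcases mem_ins.1 hy with hy | rfl
    exacts [mem_ins.2 (Or.inl (h.trans hz hy)), mem_ins.2 (Or.inl hz)]

theorem isOrdinalIn_emp : IsOrdinalIn (emp : M) :=
  isOrdinalIn_of_transitive (fun y hy => absurd hy (not_mem_emp y))
    (fun y hy => absurd hy (not_mem_emp y))

/-- The Burali-Forti theorem: no set contains all ordinals. -/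
theorem exists_ordinal_notMem (a : M) : ∃ x, IsOrdinalIn x ∧ ¬ E x a := by
  by_contra! h
  obtain ⟨s, hs⟩ := IsSet.sep a IsOrdinalIn
  have : IsOrdinalIn s := isOrdinalIn_of_transitive (fun y hy => ((hs y).1 hy).2) fun y hy z hz =>
    have hz' := ((hs y).1 hy).2.mem hz
    (hs z).2 ⟨h z hz', hz'⟩
  exact not_mem_self s ((hs s).2 ⟨h s this, this⟩)

/-- The least ordinal of `M` with the property `P`. -/
noncomputable def leastOrd (P : M → Prop) : M :=
  the fun a => IsOrdinalIn a ∧ P a ∧ ∀ b, E b a → ¬ P b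

theorem leastOrd_spec (P : M → Prop) [Dfn Set.univ (fun v : Fin 1 → M => P (v 0))]
    {x : M} (hx : IsOrdinalIn x) (hP : P x) :
    IsOrdinalIn (leastOrd P) ∧ P (leastOrd P) ∧ ∀ b, E b (leastOrd P) → ¬ P b := by
  obtain ⟨m, hm, hPm, hmin⟩ := exists_least_ordinal P hx hP
  refine the_spec (P := fun a => IsOrdinalIn a ∧ P a ∧ ∀ b, E b a → ¬ P b)
    ⟨m, ⟨hm, hPm, hmin⟩, fun y hy => ?_⟩
  rcases hy.1.trichotomy hm with h | h | h
  · exact absurd hy.2.1 (hmin y h)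
  · exact h
  · exact absurd hPm (hy.2.2 m h)

instance DF.leastOrd {P : (α → M) → M → Prop}
    [Dfn A (fun w : Option α → M => P (fun a => w (some a)) (w none))] :
    DF A (fun v => leastOrd (P v)) := by
  have : Dfn A (fun w : Option (Option α) → M =>
      P (fun a => w (some (some a))) (w none)) :=
    Dfn.reindex (P := fun w : Option α → M => P (fun a => w (some a)) (w none)) inferInstance
      (fun o : Option α => o.elim none (fun a => some (some a)))
  unfold AlgSet.leastOrd
  infer_instance

/-- There is a limit ordinal. -/
theorem exists_limit_ordinal : ∃ l : M, IsOrdinalIn l ∧ E emp l ∧ ∀ x, E x l → E (ins x x) l := by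
  obtain ⟨w, ⟨e, hew, he⟩, hw⟩ := ZFModel.inf (M := M)
  have hsucc : ∀ x, E x w → E (ins x x) w := by
    intro x hx
    obtain ⟨y, hy, hyx⟩ := hw x hx
    rwa [show ins x x = y from ext fun z => mem_ins.trans (hyx z).symm]
  rw [eq_emp.2 he] at hew
  obtain ⟨s, hs⟩ := IsSet.sep w IsOrdinalIn
  -- The content is that each ordinal in `w` lies in the union, because its successor is again an
  -- ordinal in `w`.
  have hmem : ∀ x, E x (sUnion s) ↔ E x w ∧ IsOrdinalIn x ∨ E x (sUnion s) := by
    intro x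
    refine ⟨Or.inr, ?_⟩
    rintro (⟨h1, h2⟩ | h)
    · exact mem_sUnion.2 ⟨ins x x, (hs _).2 ⟨hsucc x h1, h2.succ⟩, mem_ins.2 (Or.inr rfl)⟩
    · exact h
  refine ⟨sUnion s, isOrdinalIn_sUnion fun y hy => ((hs y).1 hy).2,
    (hmem _).2 (Or.inl ⟨hew, isOrdinalIn_emp⟩), fun x hx => ?_⟩
  obtain ⟨y, hy, hxy⟩ := mem_sUnion.1 hx
  obtain ⟨hyw, hyo⟩ := (hs y).1 hy
  have hxo := hyo.mem hxy
  rcases hxo.succ.trichotomy hyo with h | h | h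
  · exact mem_sUnion.2 ⟨y, hy, h⟩
  · exact (hmem _).2 (Or.inl ⟨h ▸ hyw, hxo.succ⟩)
  · rcases mem_ins.1 h with h | h
    · exact absurd (hxo.trans hxy h) (not_mem_self x)
    · exact absurd (h ▸ hxy) (not_mem_self x)

end Ordinals

/-! ### Recursion along the ordinals -/

section Recursion

variable {M : Type u} [LSet.Structure M] [ZFModel M] {A : Set M} {α : Type}

/-- The restriction of the function `f` to `d`. -/
noncomputable def restr (f d : M) : M :=
  toSet fun p => E p f ∧ ∃ x, E x d ∧ ∃ y, p = opair x y

theorem mem_restr {f d p : M} : E p (restr f d) ↔ E p f ∧ ∃ x, E x d ∧ ∃ y, p = opair x y :=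
  IsSet.mem_toSet (IsSet.of_subset (a := f) (fun _ h => h.1) inferInstance)

instance DF.restr {f g : (α → M) → M} [hf : DF A f] [hg : DF A g] :
    DF A (fun v => restr (f v) (g v)) := DF.comp2 (by unfold AlgSet.restr; infer_instance) hf hg

/-- `f` is a function on the ordinal `x` obeying the recursion `f(d) = H(f ↾ d)`. -/
def Attempt (H : M → M) (f x : M) : Prop :=
  (∀ p, E p f → ∃ d, E d x ∧ ∃ y, p = opair d y) ∧
    ∀ d, E d x → ∀ y, E (opair d y) f ↔ y = H (restr f d)

/-- The class function on ordinals with `f(x) = H(f ↾ x)`. -/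
noncomputable def recOrd (H : M → M) (x : M) : M := the fun y => ∃ f, Attempt H f x ∧ y = H f

/-- The graph of `recOrd H` on the elements of `x`. -/
noncomputable def recGraph (H : M → M) (x : M) : M :=
  toSet fun p => ∃ d, E d x ∧ p = opair d (recOrd H d)

theorem DF.recOrd {H : M → M} (hH : DF A (fun v : Fin 1 → M => H (v 0))) {f : (α → M) → M}
    (hf : DF A f) : DF A (fun v => recOrd H (f v)) := by
  -- A local instance, by which instance search can pass through `H`; the same device recurs below.
  have h {β : Type} {g : (β → M) → M} [hg : DF A g] : DF A (fun v => H (g v)) := hH.comp1 hg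
  exact DF.comp1 (by unfold AlgSet.recOrd Attempt; infer_instance) hf

variable {H : M → M}

theorem mem_recGraph (hH : DF Set.univ (fun v : Fin 1 → M => H (v 0))) {x p : M} :
    E p (recGraph H x) ↔ ∃ d, E d x ∧ p = opair d (recOrd H d) := by
  have h {β : Type} {g : (β → M) → M} [hg : DF Set.univ g] :
    DF Set.univ (fun v => recOrd H (g v)) := DF.recOrd hH hg
  exact IsSet.mem_toSet (IsSet.image x fun d => opair d (recOrd H d))

theorem opair_mem_recGraph (hH : DF Set.univ (fun v : Fin 1 → M => H (v 0))) {x d y : M} :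
    E (opair d y) (recGraph H x) ↔ E d x ∧ y = recOrd H d := by
  rw [mem_recGraph hH]
  constructor
  · rintro ⟨d', hd', h⟩
    obtain ⟨rfl, rfl⟩ := opair_inj.1 h
    exact ⟨hd', rfl⟩
  · rintro ⟨hd, rfl⟩
    exact ⟨d, hd, rfl⟩

/-- The value at `d` depends only on the restriction to `d`, and by induction the two restrictions
agree. -/
theorem Attempt.unique {f g x : M} (hx : IsOrdinalIn x) (hf : Attempt H f x) (hg : Attempt H g x) :
    f = g := by
  have key : ∀ d, IsOrdinalIn d → E d x → ∀ y, E (opair d y) f ↔ E (opair d y) g := by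
    intro d hd
    refine ordinal_induction (fun d => E d x → ∀ y, E (opair d y) f ↔ E (opair d y) g) ?_ hd
    intro d hd ih hdx y
    have : restr f d = restr g d := by
      refine ext fun p => ?_
      rw [mem_restr, mem_restr]
      refine and_congr_left ?_
      rintro ⟨e, he, z, rfl⟩
      exact ih e he (hx.trans he hdx) z
    rw [hf.2 d hdx, hg.2 d hdx, this]
  refine ext fun p => ⟨fun hp => ?_, fun hp => ?_⟩
  · obtain ⟨d, hd, y, rfl⟩ := hf.1 p hp
    exact (key d (hx.mem hd) hd y).1 hp
  · obtain ⟨d, hd, y, rfl⟩ := hg.1 p hp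
    exact (key d (hx.mem hd) hd y).2 hp

theorem recOrd_eq_of_attempt {f x : M} (hx : IsOrdinalIn x) (hf : Attempt H f x) :
    recOrd H x = H f := by
  refine the_eq ⟨f, hf, rfl⟩ ?_
  rintro y ⟨g, hg, rfl⟩
  rw [Attempt.unique hx hf hg]

/-- The graph up to `x` restricts to the graph up to `d`. By induction the latter is an attempt, so
it computes the value at `d`. -/
theorem attempt_recGraph (hH : DF Set.univ (fun v : Fin 1 → M => H (v 0))) {x : M}
    (hx : IsOrdinalIn x) : Attempt H (recGraph H x) x := by
  have h1 {β : Type} {g : (β → M) → M} [hg : DF Set.univ g] : DF Set.univ (fun v => H (g v)) :=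
    hH.comp1 hg
  have h2 {β : Type} {g : (β → M) → M} [hg : DF Set.univ g] :
    DF Set.univ (fun v => recOrd H (g v)) := DF.recOrd hH hg
  have h3 {β : Type} {g : (β → M) → M} [hg : DF Set.univ g] :
      DF Set.univ (fun v => recGraph H (g v)) :=
    DF.comp1 (by unfold recGraph; infer_instance) hg
  have h4 : Dfn Set.univ (fun v : Fin 1 → M => Attempt H (recGraph H (v 0)) (v 0)) := by
    unfold Attempt; infer_instance
  refine ordinal_induction (fun x => Attempt H (recGraph H x) x) (fun x hx ih => ?_) hx
  constructor
  · intro p hp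
    obtain ⟨d, hd, rfl⟩ := (mem_recGraph hH).1 hp
    exact ⟨d, hd, _, rfl⟩
  · intro d hd y
    have : restr (recGraph H x) d = recGraph H d := by
      refine ext fun p => ?_
      rw [mem_restr, mem_recGraph hH, mem_recGraph hH]
      constructor
      · rintro ⟨⟨e, he, rfl⟩, e', he', z, h⟩
        obtain ⟨rfl, rfl⟩ := opair_inj.1 h
        exact ⟨e, he', rfl⟩
      · rintro ⟨e, he, rfl⟩
        exact ⟨⟨e, hx.trans he hd, rfl⟩, e, he, _, rfl⟩
    rw [opair_mem_recGraph hH, this, recOrd_eq_of_attempt (hx.mem hd) (ih d hd)]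
    simp [hd]

theorem recOrd_eq (hH : DF Set.univ (fun v : Fin 1 → M => H (v 0))) {x : M}
    (hx : IsOrdinalIn x) : recOrd H x = H (recGraph H x) :=
  recOrd_eq_of_attempt hx (attempt_recGraph hH hx)

end Recursion

/-! ### Foundation for classes, the cumulative hierarchy and collection -/

section Foundation

variable {M : Type u} [LSet.Structure M] [ZFModel M] {A : Set M} {α : Type}

/-- The step of the recursion that leads from `a` to its transitive closure. -/
noncomputable def tcStep (a f : M) : M :=
  toSet fun z => E z a ∨ ∃ d, ∃ y, E (opair d y) f ∧ ∃ u, E u y ∧ E z u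

/-- The recursion is `T(x) = a ∪ ⋃_{d ∈ x} ⋃ T(d)`. At a limit ordinal `T` is transitive: if `y`
enters through stage `d`, its elements enter through stage `d + 1`. -/
theorem exists_transitive (a : M) : ∃ t, Sub a t ∧ ∀ y, E y t → ∀ z, E z y → E z t := by
  have hH : DF Set.univ (fun v : Fin 1 → M => tcStep a (v 0)) := by unfold tcStep; infer_instance
  have h2 {β : Type} {g : (β → M) → M} [hg : DF Set.univ g] :
    DF Set.univ (fun v => recOrd (tcStep a) (g v)) := DF.recOrd hH hg
  have key : ∀ x, IsOrdinalIn x → ∀ z, E z (recOrd (tcStep a) x) ↔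
      E z a ∨ ∃ d, E d x ∧ ∃ u, E u (recOrd (tcStep a) d) ∧ E z u := by
    intro x hx z
    have : IsSet fun z => E z a ∨ ∃ d, ∃ y, E (opair d y) (recGraph (tcStep a) x) ∧
        ∃ u, E u y ∧ E z u := by
      obtain ⟨b, hb⟩ := IsSet.biUnion x fun d => sUnion (recOrd (tcStep a) d)
      refine ⟨sUnion (upair a b), fun z => ?_⟩
      rw [mem_sUnion]
      simp only [mem_upair]
      constructor
      · rintro ⟨y, rfl | rfl, hz⟩
        · exact Or.inl hz
        · obtain ⟨d, hd, hz⟩ := (hb z).1 hz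
          exact Or.inr ⟨d, _, (opair_mem_recGraph hH).2 ⟨hd, rfl⟩, mem_sUnion.1 hz⟩
      · rintro (hz | ⟨d, y, hd, hu⟩)
        · exact ⟨a, Or.inl rfl, hz⟩
        · obtain ⟨hd', rfl⟩ := (opair_mem_recGraph hH).1 hd
          exact ⟨b, Or.inr rfl, (hb z).2 ⟨d, hd', mem_sUnion.2 hu⟩⟩
    rw [recOrd_eq hH hx, tcStep, IsSet.mem_toSet this]
    refine or_congr Iff.rfl ⟨?_, ?_⟩
    · rintro ⟨d, y, hd, hu⟩
      obtain ⟨hd', rfl⟩ := (opair_mem_recGraph hH).1 hd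
      exact ⟨d, hd', hu⟩
    · rintro ⟨d, hd, hu⟩
      exact ⟨d, _, (opair_mem_recGraph hH).2 ⟨hd, rfl⟩, hu⟩
  obtain ⟨l, hl, h0, hs⟩ := exists_limit_ordinal (M := M)
  refine ⟨recOrd (tcStep a) l, fun z hz => (key l hl z).2 (Or.inl hz), fun y hy z hz => ?_⟩
  rcases (key l hl y).1 hy with h | ⟨d, hd, u, hu, hyu⟩
  · exact (key l hl z).2 (Or.inr ⟨emp, h0, y, (key emp isOrdinalIn_emp y).2 (Or.inl h), hz⟩)
  · refine (key l hl z).2 (Or.inr ⟨ins d d, hs d hd, y, ?_, hz⟩)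
    exact (key _ (hl.mem hd).succ y).2 (Or.inr ⟨d, mem_ins.2 (Or.inr rfl), u, hu, hyu⟩)

/-- The class may be proper, so the foundation axiom is applied to its part inside a transitive set
that includes `x`. -/
theorem exists_minimal (P : M → Prop) [Dfn Set.univ (fun v : Fin 1 → M => P (v 0))]
    {x : M} (hP : P x) : ∃ m, P m ∧ ∀ y, E y m → ¬ P y := by
  obtain ⟨t, hxt, ht⟩ := exists_transitive x
  by_cases h : ∃ y, E y x ∧ P y
  · obtain ⟨s, hs⟩ := IsSet.sep t P
    obtain ⟨y, hy, hPy⟩ := h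
    obtain ⟨m, hm, hmin⟩ := ZFModel.found s ⟨y, (hs y).2 ⟨hxt y hy, hPy⟩⟩
    refine ⟨m, ((hs m).1 hm).2, fun z hz hPz => hmin ⟨z, (hs z).2 ⟨?_, hPz⟩, hz⟩⟩
    exact ht m ((hs m).1 hm).1 z hz
  · push Not at h
    exact ⟨x, hP, h⟩

/-- The step of the recursion defining the cumulative hierarchy. -/
noncomputable def hierarchyStep (f : M) : M :=
  toSet fun z => ∃ d, ∃ y, E (opair d y) f ∧ Sub z y

/-- The cumulative hierarchy of `M`. -/
noncomputable def hierarchy (x : M) : M := recOrd hierarchyStep x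

theorem DF.hierarchyStep : DF A (fun v : Fin 1 → M => hierarchyStep (v 0)) := by
  unfold AlgSet.hierarchyStep; infer_instance

instance DF.hierarchy {f : (α → M) → M} [hf : DF A f] : DF A (fun v => hierarchy (f v)) :=
  DF.recOrd DF.hierarchyStep hf

theorem mem_hierarchy {x z : M} (hx : IsOrdinalIn x) :
    E z (hierarchy x) ↔ ∃ d, E d x ∧ Sub z (hierarchy d) := by
  have : IsSet fun z => ∃ d, ∃ y, E (opair d y) (recGraph hierarchyStep x) ∧ Sub z y := by
    obtain ⟨b, hb⟩ := IsSet.biUnion x fun d => pow (hierarchy d)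
    refine ⟨b, fun z => ?_⟩
    simp only [hb, mem_pow, opair_mem_recGraph DF.hierarchyStep, hierarchy, and_assoc,
      exists_and_left, exists_eq_left]
  rw [hierarchy, recOrd_eq DF.hierarchyStep hx, hierarchyStep, IsSet.mem_toSet this]
  simp only [opair_mem_recGraph DF.hierarchyStep, hierarchy, and_assoc, exists_and_left,
    exists_eq_left]

/-- Replacement applies to the least witnesses. Taking the union of their successors makes each
witness an element of the bound. -/
theorem exists_bound (a : M) (P : M → M → Prop)
    [Dfn Set.univ (fun v : Fin 2 → M => P (v 0) (v 1))]
    (h : ∀ x, E x a → ∃ b, IsOrdinalIn b ∧ P x b) :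
    ∃ c, IsOrdinalIn c ∧ ∀ x, E x a → ∃ b, E b c ∧ P x b := by
  have hP {β : Type} {f g : (β → M) → M} [hf : DF Set.univ f] [hg : DF Set.univ g] :
    Dfn Set.univ (fun v => P (f v) (g v)) := Dfn.comp2 inferInstance hf hg
  have hspec : ∀ x, E x a → _ := fun x hx =>
    let ⟨b, hb, hxb⟩ := h x hx
    leastOrd_spec (P x) hb hxb
  obtain ⟨s, hs⟩ := IsSet.image a fun x => ins (leastOrd (P x)) (leastOrd (P x))
  refine ⟨sUnion s, isOrdinalIn_sUnion fun y hy => ?_, fun x hx => ?_⟩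
  · obtain ⟨x, hx, rfl⟩ := (hs y).1 hy
    exact (hspec x hx).1.succ
  · exact ⟨_, mem_sUnion.2 ⟨_, (hs _).2 ⟨x, hx, rfl⟩, mem_ins.2 (Or.inr rfl)⟩, (hspec x hx).2.1⟩

/-- In an ∈-minimal counterexample the elements all have ranks, and these are bounded. -/
theorem exists_sub_hierarchy (x : M) : ∃ d, IsOrdinalIn d ∧ Sub x (hierarchy d) := by
  by_contra hx
  obtain ⟨m, hm, hmin⟩ := exists_minimal
    (fun x : M => ¬ ∃ d, IsOrdinalIn d ∧ Sub x (hierarchy d)) hx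
  obtain ⟨c, hc, h⟩ := exists_bound m (fun x d => IsOrdinalIn d ∧ Sub x (hierarchy d))
    fun y hy => by
      obtain ⟨d, hd⟩ := not_not.1 (hmin y hy)
      exact ⟨d, hd.1, hd⟩
  refine hm ⟨c, hc, fun z hz => ?_⟩
  obtain ⟨b, hb, h1⟩ := h z hz
  exact (mem_hierarchy hc).2 ⟨b, hb, h1.2⟩

theorem hierarchy_mono {x y : M} (hx : IsOrdinalIn x) (hy : IsOrdinalIn y) (h : Sub x y) :
    Sub (hierarchy x) (hierarchy y) := fun _ hz =>
  have ⟨d, hd, hzd⟩ := (mem_hierarchy hx).1 hz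
  (mem_hierarchy hy).2 ⟨d, h d hd, hzd⟩

theorem sub_hierarchy_of_mem {x y : M} (hx : IsOrdinalIn x) (h : E y (hierarchy x)) :
    Sub y (hierarchy x) := fun z hz =>
  have ⟨_, hd, hyd⟩ := (mem_hierarchy hx).1 h
  hierarchy_mono (hx.mem hd) hx (fun _ ht => hx.trans ht hd) z (hyd z hz)

/-- Collection into a level of the cumulative hierarchy. -/
theorem collection (a : M) (P : M → M → Prop)
    [Dfn Set.univ (fun v : Fin 2 → M => P (v 0) (v 1))] :
    ∃ c, IsOrdinalIn c ∧ Sub a (hierarchy c) ∧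
      ∀ x, E x a → (∃ y, P x y) → ∃ y, E y (hierarchy c) ∧ P x y := by
  have hP {β : Type} {f g : (β → M) → M} [hf : DF Set.univ f] [hg : DF Set.univ g] :
    Dfn Set.univ (fun v => P (f v) (g v)) := Dfn.comp2 inferInstance hf hg
  -- Witnesses are replaced by bounds on their rank, since only ordinals have least choices. The
  -- clause about `x` is what puts `a` inside the level.
  obtain ⟨c, hc, h⟩ := exists_bound a
    (fun x d => IsOrdinalIn d ∧ Sub x (hierarchy d) ∧
      ((∃ y, P x y) → ∃ y, Sub y (hierarchy d) ∧ P x y))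
    fun x hx => by
      obtain ⟨d, hd, hxd⟩ := exists_sub_hierarchy x
      by_cases hy : ∃ y, P x y
      · obtain ⟨y, hy⟩ := hy
        obtain ⟨e, he, hye⟩ := exists_sub_hierarchy y
        rcases hd.trichotomy he with h | rfl | h
        · have := hierarchy_mono hd he fun _ ht => he.trans ht h
          exact ⟨e, he, he, fun z hz => this z (hxd z hz), fun _ => ⟨y, hye, hy⟩⟩
        · exact ⟨d, he, hd, hxd, fun _ => ⟨y, hye, hy⟩⟩
        · have := hierarchy_mono he hd fun _ ht => hd.trans ht h
          exact ⟨d, hd, hd, hxd, fun _ => ⟨y, fun z hz => this z (hye z hz), hy⟩⟩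
      · exact ⟨d, hd, hd, hxd, fun h => absurd h hy⟩
  refine ⟨c, hc, fun x hx => ?_, fun x hx hy => ?_⟩
  · obtain ⟨b, hb, h1⟩ := h x hx
    exact (mem_hierarchy hc).2 ⟨b, hb, h1.2.1⟩
  · obtain ⟨b, hb, h1⟩ := h x hx
    obtain ⟨y, hy, hxy⟩ := h1.2.2 hy
    exact ⟨y, (mem_hierarchy hc).2 ⟨b, hb, hy⟩, hxy⟩

end Foundation

/-! ### Enumerating a class closed under a definable operation -/

section Enumeration

variable {M : Type u} [LSet.Structure M] [ZFModel M] {A : Set M} {α : Type}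

/-- The value of the function `f` at `d`. -/
noncomputable def app (f d : M) : M := the fun y => E (opair d y) f

instance DF.app {f g : (α → M) → M} [hf : DF A f] [hg : DF A g] :
    DF A (fun v => app (f v) (g v)) := DF.comp2 (by unfold AlgSet.app; infer_instance) hf hg

/-- The value of `F` at the indices `d, a, b, c` and at the values of `f` at `a, b, c` is not
a value of `f`. -/
def NewValue (F : M → M → M → M → M → M) (f d a b c : M) : Prop :=
  ¬ ∃ t, E (opair t (F d a (app f a) (app f b) (app f c))) f

/-- Every element of `m` is in the domain of `f`, and indices in `m` give a new value. -/
def NewBelow (F : M → M → M → M → M → M) (f m : M) : Prop :=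
  (∀ t, E t m → ∃ y, E (opair t y) f) ∧
    ∃ d, E d m ∧ ∃ a, E a m ∧ ∃ b, E b m ∧ ∃ c, E c m ∧ NewValue F f d a b c

/-- The least bound on indices that give a new value. -/
noncomputable def newBound (F : M → M → M → M → M → M) (f : M) : M := leastOrd (NewBelow F f)

/-- The first of the least indices that give a new value. -/
noncomputable def newIndex₁ (F : M → M → M → M → M → M) (f : M) : M :=
  leastOrd fun d => E d (newBound F f) ∧ ∃ a, E a (newBound F f) ∧ ∃ b, E b (newBound F f) ∧
    ∃ c, E c (newBound F f) ∧ NewValue F f d a b c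

/-- The second of the least indices that give a new value. -/
noncomputable def newIndex₂ (F : M → M → M → M → M → M) (f : M) : M :=
  leastOrd fun a => E a (newBound F f) ∧ ∃ b, E b (newBound F f) ∧
    ∃ c, E c (newBound F f) ∧ NewValue F f (newIndex₁ F f) a b c

/-- The third of the least indices that give a new value. -/
noncomputable def newIndex₃ (F : M → M → M → M → M → M) (f : M) : M :=
  leastOrd fun b => E b (newBound F f) ∧
    ∃ c, E c (newBound F f) ∧ NewValue F f (newIndex₁ F f) (newIndex₂ F f) b c

/-- The last of the least indices that give a new value. -/
noncomputable def newIndex₄ (F : M → M → M → M → M → M) (f : M) : M :=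
  leastOrd fun c => E c (newBound F f) ∧
    NewValue F f (newIndex₁ F f) (newIndex₂ F f) (newIndex₃ F f) c

/-- The first new value. -/
noncomputable def newValue (F : M → M → M → M → M → M) (f : M) : M :=
  F (newIndex₁ F f) (newIndex₂ F f) (app f (newIndex₂ F f)) (app f (newIndex₃ F f))
    (app f (newIndex₄ F f))

section

variable {F : M → M → M → M → M → M}
  (hF : DF A (fun v : Fin 5 → M => F (v 0) (v 1) (v 2) (v 3) (v 4)))
include hF

theorem DF.newIndex :
    DF A (fun v : Fin 1 → M => newBound F (v 0)) ∧ DF A (fun v : Fin 1 → M => newIndex₁ F (v 0)) ∧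
      DF A (fun v : Fin 1 → M => newIndex₂ F (v 0)) ∧
      DF A (fun v : Fin 1 → M => newIndex₃ F (v 0)) ∧
      DF A (fun v : Fin 1 → M => newIndex₄ F (v 0)) := by
  have hF' {β : Type} {f g h k l : (β → M) → M} [hf : DF A f] [hg : DF A g] [hh : DF A h]
      [hk : DF A k] [hl : DF A l] : DF A (fun v => F (f v) (g v) (h v) (k v) (l v)) :=
    hF.comp5 hf hg hh hk hl
  have h0 : DF A (fun v : Fin 1 → M => newBound F (v 0)) := by
    unfold newBound NewBelow NewValue; infer_instance
  have h0' {β : Type} {f : (β → M) → M} [hf : DF A f] : DF A (fun v => newBound F (f v)) :=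
    h0.comp1 hf
  have h1 : DF A (fun v : Fin 1 → M => newIndex₁ F (v 0)) := by
    unfold newIndex₁ NewValue; infer_instance
  have h1' {β : Type} {f : (β → M) → M} [hf : DF A f] : DF A (fun v => newIndex₁ F (f v)) :=
    h1.comp1 hf
  have h2 : DF A (fun v : Fin 1 → M => newIndex₂ F (v 0)) := by
    unfold newIndex₂ NewValue; infer_instance
  have h2' {β : Type} {f : (β → M) → M} [hf : DF A f] : DF A (fun v => newIndex₂ F (f v)) :=
    h2.comp1 hf
  have h3 : DF A (fun v : Fin 1 → M => newIndex₃ F (v 0)) := by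
    unfold newIndex₃ NewValue; infer_instance
  have h3' {β : Type} {f : (β → M) → M} [hf : DF A f] : DF A (fun v => newIndex₃ F (f v)) :=
    h3.comp1 hf
  have h4 : DF A (fun v : Fin 1 → M => newIndex₄ F (v 0)) := by
    unfold newIndex₄ NewValue; infer_instance
  exact ⟨h0, h1, h2, h3, h4⟩

theorem DF.newValue : DF A (fun v : Fin 1 → M => newValue F (v 0)) := by
  obtain ⟨h0, h1, h2, h3, h4⟩ := DF.newIndex hF
  exact hF.comp5 h1 h2 (DF.app (hf := DF.var _) (hg := h2)) (DF.app (hf := DF.var _) (hg := h3))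
    (DF.app (hf := DF.var _) (hg := h4))

end

variable {F : M → M → M → M → M → M}

/-- The bound is minimized before the single indices, so all four chosen indices stay below any `m`
that admits a new value. A plain lexicographic choice would not confine them to a set. -/
theorem newValue_spec (hF : DF Set.univ (fun v : Fin 5 → M => F (v 0) (v 1) (v 2) (v 3) (v 4)))
    {f m : M} (hm : IsOrdinalIn m) (h : NewBelow F f m) :
    (¬ ∃ t, E (opair t (newValue F f)) f) ∧ ∃ d, E d m ∧ ∃ a, E a m ∧ ∃ b, E b m ∧ ∃ c, E c m ∧
      newValue F f = F d a (app f a) (app f b) (app f c) := by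
  have hF' {β : Type} {f g h k l : (β → M) → M} [hf : DF Set.univ f] [hg : DF Set.univ g]
      [hh : DF Set.univ h] [hk : DF Set.univ k] [hl : DF Set.univ l] :
      DF Set.univ (fun v => F (f v) (g v) (h v) (k v) (l v)) := hF.comp5 hf hg hh hk hl
  obtain ⟨ho, ⟨-, h0⟩, hmin⟩ := @leastOrd_spec M _ _ (NewBelow F f)
    (by unfold NewBelow NewValue; infer_instance) m hm h
  have hsub : Sub (newBound F f) m := by
    intro t ht
    rcases ho.trichotomy hm with h1 | h1 | h1
    · exact hm.trans ht h1
    · exact h1 ▸ ht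
    · exact absurd h (hmin m h1)
  change IsOrdinalIn (newBound F f) at ho
  obtain ⟨d, hd, h0⟩ := h0
  obtain ⟨-, ⟨hd, a, ha, h0⟩, -⟩ := @leastOrd_spec M _ _ (fun d => E d (newBound F f) ∧
    ∃ a, E a (newBound F f) ∧ ∃ b, E b (newBound F f) ∧
    ∃ c, E c (newBound F f) ∧ NewValue F f d a b c) (by unfold NewValue; infer_instance)
    d (ho.mem hd) ⟨hd, h0⟩
  obtain ⟨-, ⟨ha, b, hb, h0⟩, -⟩ := @leastOrd_spec M _ _ (fun a => E a (newBound F f) ∧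
    ∃ b, E b (newBound F f) ∧ ∃ c, E c (newBound F f) ∧ NewValue F f (newIndex₁ F f) a b c)
    (by unfold NewValue; infer_instance) a (ho.mem ha) ⟨ha, h0⟩
  obtain ⟨-, ⟨hb, c, hc, h0⟩, -⟩ := @leastOrd_spec M _ _ (fun b => E b (newBound F f) ∧
    ∃ c, E c (newBound F f) ∧ NewValue F f (newIndex₁ F f) (newIndex₂ F f) b c)
    (by unfold NewValue; infer_instance) b (ho.mem hb) ⟨hb, h0⟩
  obtain ⟨-, ⟨hc, h0⟩, -⟩ := @leastOrd_spec M _ _ (fun c => E c (newBound F f) ∧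
    NewValue F f (newIndex₁ F f) (newIndex₂ F f) (newIndex₃ F f) c)
    (by unfold NewValue; infer_instance) c (ho.mem hc) ⟨hc, h0⟩
  exact ⟨h0, _, hsub _ hd, _, hsub _ ha, _, hsub _ hb, _, hsub _ hc, rfl⟩

theorem IsOrdinalIn.exists_common_bound {x y : M} (hx : IsOrdinalIn x) (hy : IsOrdinalIn y) :
    ∃ z, IsOrdinalIn z ∧ E x z ∧ E y z := by
  rcases hx.trichotomy hy with h | rfl | h
  · exact ⟨_, hy.succ, mem_ins.2 (Or.inl h), mem_ins.2 (Or.inr rfl)⟩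
  · exact ⟨_, hy.succ, mem_ins.2 (Or.inr rfl), mem_ins.2 (Or.inr rfl)⟩
  · exact ⟨_, hx.succ, mem_ins.2 (Or.inr rfl), mem_ins.2 (Or.inl h)⟩

/-- For every definable operation there is a definable enumeration along the ordinals of a class
closed under the operation. -/
theorem exists_enumeration (F : M → M → M → M → M → M)
    (hF : DF (∅ : Set M) (fun v : Fin 5 → M => F (v 0) (v 1) (v 2) (v 3) (v 4))) :
    ∃ e : M → M, DF (∅ : Set M) (fun v : Fin 1 → M => e (v 0)) ∧
      ∀ d a b c, IsOrdinalIn d → IsOrdinalIn a → IsOrdinalIn b → IsOrdinalIn c →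
        ∃ t, IsOrdinalIn t ∧ e t = F d a (e a) (e b) (e c) := by
  have hFu := hF.mono (Set.empty_subset Set.univ)
  have hN := DF.newValue hFu
  refine ⟨recOrd (newValue F), DF.recOrd (DF.newValue hF) (DF.var 0), ?_⟩
  intro d a b c hd ha hb hc
  by_contra! hnew
  set e := recOrd (newValue F) with he
  have he' {β : Type} {f : (β → M) → M} [hf : DF Set.univ f] : DF Set.univ (fun v => e (f v)) :=
    DF.recOrd hN hf
  have hF' {β : Type} {f g h k l : (β → M) → M} [hf : DF Set.univ f] [hg : DF Set.univ g]
      [hh : DF Set.univ h] [hk : DF Set.univ k] [hl : DF Set.univ l] :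
      DF Set.univ (fun v => F (f v) (g v) (h v) (k v) (l v)) := hFu.comp5 hf hg hh hk hl
  have happ : ∀ {x t}, E t x → app (recGraph (newValue F) x) t = e t := fun {x t} ht =>
    the_eq ((opair_mem_recGraph hN).2 ⟨ht, rfl⟩) fun y hy => ((opair_mem_recGraph hN).1 hy).2
  obtain ⟨m, hm, hdm, ham, hbm, hcm⟩ : ∃ m, IsOrdinalIn m ∧ E d m ∧ E a m ∧ E b m ∧ E c m := by
    obtain ⟨x, hx, h1, h2⟩ := hd.exists_common_bound ha
    obtain ⟨y, hy, h3, h4⟩ := hb.exists_common_bound hc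
    obtain ⟨z, hz, h5, h6⟩ := hx.exists_common_bound hy
    exact ⟨z, hz, hz.trans h1 h5, hz.trans h2 h5, hz.trans h3 h6, hz.trans h4 h6⟩
  -- The missing value keeps a new value available at every stage from `m` on. So `e` never repeats
  -- an earlier value there, and its values use only indices in `m`.
  have key : ∀ x, IsOrdinalIn x → Sub m x → (∀ t, E t x → e t ≠ e x) ∧
      ∃ d, E d m ∧ ∃ a, E a m ∧ ∃ b, E b m ∧ ∃ c, E c m ∧ e x = F d a (e a) (e b) (e c) := by
    intro x hx hmx
    have h1 : e x = newValue F (recGraph (newValue F) x) := recOrd_eq hN hx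
    have h2 : NewBelow F (recGraph (newValue F) x) m := by
      refine ⟨fun t ht => ⟨e t, (opair_mem_recGraph hN).2 ⟨hmx t ht, rfl⟩⟩,
        d, hdm, a, ham, b, hbm, c, hcm, ?_⟩
      rintro ⟨t, ht⟩
      obtain ⟨htx, h⟩ := (opair_mem_recGraph hN).1 ht
      rw [happ (hmx a ham), happ (hmx b hbm), happ (hmx c hcm)] at h
      exact hnew t (hx.mem htx) h.symm
    obtain ⟨h3, d', hd', a', ha', b', hb', c', hc', h4⟩ := newValue_spec hFu hm h2
    rw [happ (hmx a' ha'), happ (hmx b' hb'), happ (hmx c' hc'), ← h1] at h4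
    rw [← h1] at h3
    refine ⟨fun t ht h => h3 ⟨t, (opair_mem_recGraph hN).2 ⟨ht, h.symm⟩⟩,
      d', hd', a', ha', b', hb', c', hc', h4⟩
  -- With the indices confined to `m`, one image and three unions collect the values, one index at a
  -- time.
  have hS : ∃ s, ∀ x, IsOrdinalIn x → Sub m x → E (e x) s := by
    have i4 d a b := IsSet.image m fun c => F d a (e a) (e b) (e c)
    have i3 d a := IsSet.biUnion m fun b => toSet fun z => ∃ c, E c m ∧ z = F d a (e a) (e b) (e c)
    have i2 d := IsSet.biUnion m fun a => toSet fun z => ∃ b, E b m ∧ E z (toSet fun z =>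
      ∃ c, E c m ∧ z = F d a (e a) (e b) (e c))
    obtain ⟨s, hs⟩ := IsSet.biUnion m fun d => toSet fun z => ∃ a, E a m ∧ E z (toSet fun z =>
      ∃ b, E b m ∧ E z (toSet fun z => ∃ c, E c m ∧ z = F d a (e a) (e b) (e c)))
    refine ⟨s, fun x hx hmx => ?_⟩
    obtain ⟨-, d, hd, a, ha, b, hb, c, hc, h⟩ := key x hx hmx
    exact (hs _).2 ⟨d, hd, (i2 d).mem_toSet.2 ⟨a, ha, (i3 d a).mem_toSet.2
      ⟨b, hb, (i4 d a b).mem_toSet.2 ⟨c, hc, h⟩⟩⟩⟩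
  obtain ⟨s, hs⟩ := hS
  -- Inverting `e` on the set of values recovers every ordinal that includes `m`, against
  -- Burali-Forti.
  obtain ⟨r, hr⟩ := IsSet.image s fun v => leastOrd fun x => Sub m x ∧ e x = v
  obtain ⟨x, hx, hxn⟩ := exists_ordinal_notMem (sUnion (upair r m))
  have hxr : ¬ E x r := fun h => hxn (mem_sUnion.2 ⟨r, mem_upair.2 (Or.inl rfl), h⟩)
  have hxm : ¬ E x m := fun h => hxn (mem_sUnion.2 ⟨m, mem_upair.2 (Or.inr rfl), h⟩)
  have hmx : Sub m x := by
    intro t ht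
    rcases hx.trichotomy hm with h | rfl | h
    exacts [absurd h hxm, ht, hx.trans ht h]
  refine hxr ((hr x).2 ⟨e x, hs x hx hmx, ?_⟩)
  obtain ⟨h1, h2, h3⟩ := leastOrd_spec (fun y => Sub m y ∧ e y = e x) hx ⟨hmx, rfl⟩
  rcases h1.trichotomy hx with h | h | h
  · exact absurd h2.2 ((key x hx hmx).1 _ h)
  · exact h.symm
  · exact absurd ⟨hmx, rfl⟩ (h3 x h)

end Enumeration

/-! ### Evaluating formulas by set operations -/

section Satisfaction

variable {M : Type u} [LSet.Structure M] [ZFModel M] {A : Set M} {α : Type}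

/-- The numeral of a natural number in `M`. -/
noncomputable def num : ℕ → M
  | 0 => emp
  | n + 1 => ins (num n) (num n)

theorem isOrdinalIn_num (n : ℕ) : IsOrdinalIn (num n : M) := by
  induction n with
  | zero => exact isOrdinalIn_emp
  | succ n ih => exact ih.succ

theorem num_mem_num {m n : ℕ} (h : m < n) : E (num m : M) (num n) := by
  induction n with
  | zero => omega
  | succ n ih =>
    rcases Nat.lt_succ_iff_lt_or_eq.1 h with h | rfl
    · exact mem_ins.2 (Or.inl (ih h))
    · exact mem_ins.2 (Or.inr rfl)

theorem num_injective : Function.Injective (num : ℕ → M) := by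
  intro m n h
  rcases lt_trichotomy m n with h1 | h1 | h1
  · exact absurd (h ▸ num_mem_num h1) (not_mem_self (num n))
  · exact h1
  · exact absurd (h ▸ num_mem_num h1) (not_mem_self (num n))

instance DF.num (n : ℕ) : DF A (fun _ : α → M => num n) := by
  induction n with
  | zero => exact DF.emp
  | succ n ih => exact DF.ins

/-- The set of the pairs `(i, vᵢ)`. -/
noncomputable def code : ∀ {n : ℕ}, (Fin n → M) → M
  | 0, _ => emp
  | n + 1, v => ins (opair (num n) (v (Fin.last n))) (code fun i => v i.castSucc)

theorem DF.code {n : ℕ} {f : Fin n → (α → M) → M} (hf : ∀ i, DF A (f i)) :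
    DF A (fun v => code fun i => f i v) := by
  induction n with
  | zero => exact DF.emp
  | succ n ih =>
    have h1 := ih (f := fun i => f i.castSucc) fun i => hf _
    have h2 := hf (Fin.last n)
    exact DF.ins

theorem code_snoc {n : ℕ} (v : Fin n → M) (x : M) :
    code (Fin.snoc v x : Fin (n + 1) → M) = ins (opair (num n) x) (code v) := by
  simp [code]

theorem mem_code {n : ℕ} {v : Fin n → M} {p : M} :
    E p (code v) ↔ ∃ i : Fin n, p = opair (num i) (v i) := by
  induction n with
  | zero => simp [code, not_mem_emp]
  | succ n ih => rw [code, mem_ins, ih, Fin.exists_fin_succ']; rfl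

theorem opair_mem_code {n : ℕ} {v : Fin n → M} {i : Fin n} {x : M} :
    E (opair (num i) x) (code v) ↔ x = v i := by
  rw [mem_code]
  constructor
  · rintro ⟨j, hj⟩
    obtain ⟨h1, rfl⟩ := opair_inj.1 hj
    rw [Fin.ext (num_injective h1)]
  · rintro rfl
    exact ⟨i, rfl⟩

theorem code_injective {n : ℕ} : Function.Injective (code : (Fin n → M) → M) := fun _ _ h =>
  funext fun _ => opair_mem_code.1 (h ▸ opair_mem_code.2 rfl)

/-- The set of all `t ∪ {(c, u)}` with `t ∈ x` and `u ∈ y`. -/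
noncomputable def extend (x y c : M) : M :=
  toSet fun s => ∃ t, E t x ∧ ∃ u, E u y ∧ s = ins (opair c u) t

theorem mem_extend {x y c s : M} :
    E s (extend x y c) ↔ ∃ t, E t x ∧ ∃ u, E u y ∧ s = ins (opair c u) t := by
  refine IsSet.mem_toSet ?_
  obtain ⟨b, hb⟩ := IsSet.biUnion x fun t => toSet fun s => ∃ u, E u y ∧ s = ins (opair c u) t
  refine ⟨b, fun z => (hb z).trans (exists_congr fun t => and_congr_right fun _ => ?_)⟩
  exact (IsSet.image y fun u => ins (opair c u) t).mem_toSet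

/-- The set difference in `M`. -/
noncomputable def diff (x y : M) : M := toSet fun t => E t x ∧ ¬ E t y

theorem mem_diff {x y t : M} : E t (diff x y) ↔ E t x ∧ ¬ E t y :=
  (IsSet.sep x fun t => ¬ E t y).mem_toSet

/-- The set of the assignments in `x` whose value at `y` is an element of their value at `z`. -/
noncomputable def selectMem (x y z : M) : M :=
  toSet fun t => E t x ∧ ∃ u w, E (opair y u) t ∧ E (opair z w) t ∧ E u w

theorem mem_selectMem {x y z t : M} :
    E t (selectMem x y z) ↔ E t x ∧ ∃ u w, E (opair y u) t ∧ E (opair z w) t ∧ E u w :=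
  (IsSet.sep x fun t => ∃ u w, E (opair y u) t ∧ E (opair z w) t ∧ E u w).mem_toSet

/-- The set of the assignments in `x` whose values at `y` and at `z` are equal. -/
noncomputable def selectEq (x y z : M) : M :=
  toSet fun t => E t x ∧ ∃ u w, E (opair y u) t ∧ E (opair z w) t ∧ u = w

theorem mem_selectEq {x y z t : M} :
    E t (selectEq x y z) ↔ E t x ∧ ∃ u w, E (opair y u) t ∧ E (opair z w) t ∧ u = w :=
  (IsSet.sep x fun t => ∃ u w, E (opair y u) t ∧ E (opair z w) t ∧ u = w).mem_toSet

/-- The set of those `t ∈ y` that have an extension `t ∪ {(c, u)}` in `x`. -/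
noncomputable def project (x y c : M) : M :=
  toSet fun t => E t y ∧ ∃ u, E (ins (opair c u) t) x

theorem mem_project {x y c t : M} :
    E t (project x y c) ↔ E t y ∧ ∃ u, E (ins (opair c u) t) x :=
  (IsSet.sep y fun t => ∃ u, E (ins (opair c u) t) x).mem_toSet

/-- The unique `u` such that the only element of `x` is the assignment with value `u`. -/
noncomputable def extract (x : M) : M :=
  the fun u => ∀ t, E t x ↔ t = ins (opair (num 0) u) emp

open Classical in
/-- The operation under which the class of ordinal definable sets is generated: the first
argument selects an operation, which is applied to the other arguments. -/
noncomputable def operation (d a x y z : M) : M :=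
  if d = num 0 then a else if d = num 1 then hierarchy a else if d = num 2 then diff x y
  else if d = num 3 then extend x y z else if d = num 4 then selectMem x y z
  else if d = num 5 then selectEq x y z else if d = num 6 then project x y z else extract x

theorem DF.operation :
    DF A (fun v : Fin 5 → M => operation (v 0) (v 1) (v 2) (v 3) (v 4)) := by
  unfold AlgSet.operation diff extend selectMem selectEq project extract
  infer_instance

theorem exists_eq_var {n : ℕ} (t : LSet.Term (Empty ⊕ Fin n)) : ∃ i, t = .var (.inr i) := by
  rcases t with ⟨i | i⟩ | ⟨f, _⟩
  · exact i.elim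
  · exact ⟨i, rfl⟩
  · exact Empty.elim f

variable {W : Set M}

/-- The class `W` is closed under `operation`. -/
def ClosedUnderOperation (W : Set M) : Prop :=
  (∀ d a, IsOrdinalIn d → IsOrdinalIn a → ∃ x y z, operation d a x y z ∈ W) ∧
    ∀ d x y z, IsOrdinalIn d → x ∈ W → y ∈ W → z ∈ W → ∃ a, operation d a x y z ∈ W

namespace ClosedUnderOperation

variable (hW : ClosedUnderOperation W)
include hW

/-- Operations 0 and 1 depend only on the ordinal argument and the others only on `x`, `y`, `z`.
Hence unspecified values of the remaining arguments do no harm. -/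
theorem ordinal_mem {a : M} (ha : IsOrdinalIn a) : a ∈ W := by
  obtain ⟨x, y, z, h⟩ := hW.1 (num 0) a (isOrdinalIn_num 0) ha
  simpa [operation] using h

theorem num_mem (n : ℕ) : num n ∈ W := hW.ordinal_mem (isOrdinalIn_num n)

theorem hierarchy_mem {a : M} (ha : IsOrdinalIn a) : hierarchy a ∈ W := by
  obtain ⟨x, y, z, h⟩ := hW.1 (num 1) a (isOrdinalIn_num 1) ha
  simpa [operation, num_injective.eq_iff] using h

theorem diff_mem {x y : M} (hx : x ∈ W) (hy : y ∈ W) : diff x y ∈ W := by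
  obtain ⟨a, h⟩ := hW.2 (num 2) x y y (isOrdinalIn_num 2) hx hy hy
  simpa [operation, num_injective.eq_iff] using h

theorem extend_mem {x y z : M} (hx : x ∈ W) (hy : y ∈ W) (hz : z ∈ W) : extend x y z ∈ W := by
  obtain ⟨a, h⟩ := hW.2 (num 3) x y z (isOrdinalIn_num 3) hx hy hz
  simpa [operation, num_injective.eq_iff] using h

theorem selectMem_mem {x y z : M} (hx : x ∈ W) (hy : y ∈ W) (hz : z ∈ W) :
    selectMem x y z ∈ W := by
  obtain ⟨a, h⟩ := hW.2 (num 4) x y z (isOrdinalIn_num 4) hx hy hz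
  simpa [operation, num_injective.eq_iff] using h

theorem selectEq_mem {x y z : M} (hx : x ∈ W) (hy : y ∈ W) (hz : z ∈ W) :
    selectEq x y z ∈ W := by
  obtain ⟨a, h⟩ := hW.2 (num 5) x y z (isOrdinalIn_num 5) hx hy hz
  simpa [operation, num_injective.eq_iff] using h

theorem project_mem {x y z : M} (hx : x ∈ W) (hy : y ∈ W) (hz : z ∈ W) : project x y z ∈ W := by
  obtain ⟨a, h⟩ := hW.2 (num 6) x y z (isOrdinalIn_num 6) hx hy hz
  simpa [operation, num_injective.eq_iff] using h

theorem extract_mem {x : M} (hx : x ∈ W) : extract x ∈ W := by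
  obtain ⟨a, h⟩ := hW.2 (num 7) x x x (isOrdinalIn_num 7) hx hx hx
  simpa [operation, num_injective.eq_iff] using h

theorem exists_assignments {a : M} (ha : a ∈ W) (n : ℕ) :
    ∃ s ∈ W, ∀ t, E t s ↔ ∃ v : Fin n → M, (∀ i, E (v i) a) ∧ t = code v := by
  induction n with
  | zero =>
    -- The numeral one is `{∅}`, and `∅` codes the empty assignment.
    refine ⟨num 1, hW.num_mem 1, fun t => ?_⟩
    rw [num, mem_ins]
    simp [code, num, not_mem_emp]
  | succ n ih =>
    obtain ⟨s, hs, h⟩ := ih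
    refine ⟨extend s a (num n), hW.extend_mem hs ha (hW.num_mem n), fun t => ?_⟩
    rw [mem_extend]
    constructor
    · rintro ⟨t, ht, u, hu, rfl⟩
      obtain ⟨v, hv, rfl⟩ := (h t).1 ht
      refine ⟨Fin.snoc v u, fun i => ?_, (code_snoc v u).symm⟩
      refine Fin.lastCases ?_ (fun i => ?_) i
      · simpa using hu
      · simpa using hv i
    · rintro ⟨v, hv, rfl⟩
      exact ⟨_, (h _).2 ⟨fun i => v i.castSucc, fun i => hv _, rfl⟩, _, hv _, rfl⟩

/-- Only the assignments are restricted to `a`; truth is truth in all of `M`. Connectives become set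
differences. For a quantifier, collection supplies a level containing a counterexample for each
assignment that has one, so an unbounded search becomes a projection from a set. -/
theorem exists_satisfying {n : ℕ} (φ : LSet.BoundedFormula Empty n) :
    ∀ a ∈ W, ∃ r ∈ W, ∀ t, E t r ↔
      ∃ v : Fin n → M, (∀ i, E (v i) a) ∧ t = code v ∧ φ.Realize default v := by
  induction φ with
  | falsum =>
    intro a _
    refine ⟨num 0, hW.num_mem 0, fun t => ?_⟩
    simp [num, not_mem_emp, BoundedFormula.Realize]
  | @equal n t₁ t₂ =>
    intro a ha
    obtain ⟨s, hs, h⟩ := hW.exists_assignments ha n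
    obtain ⟨i, rfl⟩ := exists_eq_var t₁
    obtain ⟨j, rfl⟩ := exists_eq_var t₂
    refine ⟨selectEq s (num i) (num j), hW.selectEq_mem hs (hW.num_mem _) (hW.num_mem _),
      fun t => ?_⟩
    rw [mem_selectEq, h]
    constructor
    · rintro ⟨⟨v, hv, rfl⟩, u, w, hu, hw, huw⟩
      rw [opair_mem_code] at hu hw
      exact ⟨v, hv, rfl, by simpa [BoundedFormula.Realize, hu, hw] using huw⟩
    · rintro ⟨v, hv, rfl, h⟩
      exact ⟨⟨v, hv, rfl⟩, v i, v j, opair_mem_code.2 rfl, opair_mem_code.2 rfl,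
        by simpa [BoundedFormula.Realize] using h⟩
  | @rel n l R ts =>
    intro a ha
    obtain ⟨s, hs, h⟩ := hW.exists_assignments ha n
    cases R
    obtain ⟨i, hi⟩ := exists_eq_var (ts 0)
    obtain ⟨j, hj⟩ := exists_eq_var (ts 1)
    have key : ∀ v : Fin n → M,
        (BoundedFormula.rel (L := LSet) MemRel.mem ts).Realize default v ↔ E (v i) (v j) := by
      intro v
      change Structure.RelMap memSym (fun k => (ts k).realize (Sum.elim default v)) ↔
        Structure.RelMap memSym _
      apply iff_of_eq
      congr 1
      ext k
      fin_cases k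
      · simp [hi]
      · simp [hj]
    refine ⟨selectMem s (num i) (num j), hW.selectMem_mem hs (hW.num_mem _) (hW.num_mem _),
      fun t => ?_⟩
    rw [mem_selectMem, h]
    constructor
    · rintro ⟨⟨v, hv, rfl⟩, u, w, hu, hw, huw⟩
      rw [opair_mem_code] at hu hw
      exact ⟨v, hv, rfl, (key v).2 (hu ▸ hw ▸ huw)⟩
    · rintro ⟨v, hv, rfl, h⟩
      exact ⟨⟨v, hv, rfl⟩, v i, v j, opair_mem_code.2 rfl, opair_mem_code.2 rfl, (key v).1 h⟩
  | @imp n φ ψ ih₁ ih₂ =>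
    intro a ha
    obtain ⟨s, hs, h⟩ := hW.exists_assignments ha n
    obtain ⟨r₁, hr₁, h₁⟩ := ih₁ a ha
    obtain ⟨r₂, hr₂, h₂⟩ := ih₂ a ha
    -- The implication fails exactly on `r₁ \ r₂`.
    refine ⟨diff s (diff r₁ r₂), hW.diff_mem hs (hW.diff_mem hr₁ hr₂), fun t => ?_⟩
    rw [mem_diff, mem_diff, h, h₁, h₂]
    constructor
    · rintro ⟨⟨v, hv, rfl⟩, hn⟩
      refine ⟨v, hv, rfl, fun h1 => ?_⟩
      by_contra h2
      refine hn ⟨⟨v, hv, rfl, h1⟩, ?_⟩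
      rintro ⟨w, -, hw, h3⟩
      exact h2 (code_injective hw ▸ h3)
    · rintro ⟨v, hv, rfl, h3⟩
      refine ⟨⟨v, hv, rfl⟩, ?_⟩
      rintro ⟨⟨w, hw, hc, h1⟩, h2⟩
      exact h2 ⟨v, hv, rfl, h3 (code_injective hc ▸ h1)⟩
  | @all n φ ih =>
    intro a ha
    obtain ⟨s, hs, h⟩ := hW.exists_assignments ha n
    have hP : Dfn Set.univ (fun w : Fin 2 → M => ∃ v : Fin n → M, w 0 = code v ∧
        ¬ φ.Realize default (Fin.snoc v (w 1) : Fin (n + 1) → M)) := by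
      apply Dfn.exists_of_finite (γ := Fin n) (Q := fun w (v : Fin n → M) => w 0 = code v ∧
        ¬ φ.Realize default (Fin.snoc v (w 1) : Fin (n + 1) → M))
      have h1 : DF Set.univ (fun w : Fin 2 ⊕ Fin n → M => code fun i => w (Sum.inr i)) :=
        DF.code fun i => DF.var _
      have h2 : Dfn Set.univ (fun w : Fin 2 ⊕ Fin n → M =>
          φ.Realize default (Fin.snoc (fun i => w (Sum.inr i)) (w (Sum.inl 1)) :
            Fin (n + 1) → M)) := by
        refine Dfn.congr ((Dfn.of_formula φ.toFormula).reindex (α := Fin 2 ⊕ Fin n)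
          (Sum.elim Empty.elim (Fin.snoc Sum.inr (Sum.inl 1)))) fun w => ?_
        rw [BoundedFormula.realize_toFormula]
        apply iff_of_eq
        congr 1
        · exact Subsingleton.elim _ _
        · ext i
          refine Fin.lastCases ?_ (fun i => ?_) i <;> simp
      infer_instance
    -- Adjoining `a` to `s` makes `a` an element, hence a subset, of the level found, so the
    -- extended assignments take all their values in that level.
    obtain ⟨c, hc, hac, hcoll⟩ := collection (ins a s) (fun t y => ∃ v : Fin n → M, t = code v ∧
      ¬ φ.Realize default (Fin.snoc v y : Fin (n + 1) → M))
    have hsub : Sub a (hierarchy c) :=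
      sub_hierarchy_of_mem hc (hac a (mem_ins.2 (Or.inr rfl)))
    obtain ⟨r, hr, hφ⟩ := ih (hierarchy c) (hW.hierarchy_mem hc)
    have hcounter : ∀ v : Fin n → M, (∀ i, E (v i) a) →
        ((∃ u, E (ins (opair (num n) u) (code v))
          (diff (extend s (hierarchy c) (num n)) r)) ↔
            ¬ ∀ u, φ.Realize default (Fin.snoc v u : Fin (n + 1) → M)) := by
      intro v hv
      push Not
      constructor
      · rintro ⟨u, hu⟩
        rw [mem_diff, hφ, mem_extend] at hu
        obtain ⟨⟨t, ht, w, hw, h1⟩, h2⟩ := hu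
        obtain ⟨v', -, rfl⟩ := (h t).1 ht
        rw [← code_snoc, ← code_snoc] at h1
        have hwu : w = u := by simpa using (congrFun (code_injective h1) (Fin.last n)).symm
        subst hwu
        refine ⟨w, fun h3 => h2 ⟨Fin.snoc v w, fun i => ?_, (code_snoc v w).symm, h3⟩⟩
        refine Fin.lastCases ?_ (fun i => ?_) i
        · simpa using hw
        · simpa using hsub _ (hv i)
      · rintro ⟨u, hu⟩
        have hvs := (h (code v)).2 ⟨v, hv, rfl⟩
        obtain ⟨y, hy, v', hv', hyφ⟩ :=
          hcoll (code v) (mem_ins.2 (Or.inl hvs)) ⟨u, v, rfl, hu⟩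
        obtain rfl := code_injective hv'
        refine ⟨y, mem_diff.2 ⟨mem_extend.2 ⟨_, hvs, y, hy, rfl⟩, fun h1 => ?_⟩⟩
        obtain ⟨w, -, h1, h2⟩ := (hφ _).1 h1
        rw [← code_snoc] at h1
        exact hyφ (code_injective h1 ▸ h2)
    refine ⟨diff s (project (diff (extend s (hierarchy c) (num n)) r) s (num n)),
      hW.diff_mem hs (hW.project_mem (hW.diff_mem (hW.extend_mem hs (hW.hierarchy_mem hc)
        (hW.num_mem n)) hr) hs (hW.num_mem n)), fun t => ?_⟩
    rw [mem_diff, mem_project]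
    constructor
    · rintro ⟨hts, hn⟩
      obtain ⟨v, hv, rfl⟩ := (h t).1 hts
      refine ⟨v, hv, rfl, ?_⟩
      rw [BoundedFormula.realize_all]
      by_contra h1
      exact hn ⟨hts, (hcounter v hv).2 h1⟩
    · rintro ⟨v, hv, rfl, h1⟩
      rw [BoundedFormula.realize_all] at h1
      exact ⟨(h _).2 ⟨v, hv, rfl⟩, fun h2 => (hcounter v hv).1 h2.2 h1⟩

/-- Inside a level containing `x`, the satisfying set of the defining formula is the singleton of
the assignment with value `x`, and `extract` reads off `x`. -/
theorem mem_of_definable {x : M} (hx : Dfn (∅ : Set M) (fun v : Fin 1 → M => v 0 = x)) :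
    x ∈ W := by
  obtain ⟨φ, hφ⟩ := hx.exists_formula
  obtain ⟨d, hd, hxd⟩ := exists_sub_hierarchy (ins x emp)
  obtain ⟨r, hr, h⟩ := hW.exists_satisfying (BoundedFormula.relabel Sum.inr φ)
    (hierarchy d) (hW.hierarchy_mem hd)
  have hmem : ∀ t, E t r ↔ t = ins (opair (num 0) x) emp := by
    intro t
    rw [h]
    constructor
    · rintro ⟨v, -, rfl, hv⟩
      rw [Formula.realize_relabel_sumInr, ← hφ] at hv
      simp [code, ← hv]
    · rintro rfl
      refine ⟨fun _ => x, fun _ => hxd x (mem_ins.2 (Or.inr rfl)), by simp [code], ?_⟩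
      rw [Formula.realize_relabel_sumInr, ← hφ]
  have : extract r = x := by
    refine the_eq hmem fun y hy => ?_
    have h1 := (hy _).1 ((hmem _).2 rfl)
    have h2 : E (opair (num 0) y) (ins (opair (num 0) x) emp) := h1 ▸ mem_ins.2 (Or.inr rfl)
    rcases mem_ins.1 h2 with h2 | h2
    · exact absurd h2 (not_mem_emp _)
    · exact (opair_inj.1 h2).2
  exact this ▸ hW.extract_mem hr

end ClosedUnderOperation

/-- There is a definable enumeration along the ordinals of a class that contains all definable
elements. -/
theorem exists_enumeration_of_definable : ∃ e : M → M,
    DF (∅ : Set M) (fun v : Fin 1 → M => e (v 0)) ∧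
      ∀ x, Dfn (∅ : Set M) (fun v : Fin 1 → M => v 0 = x) → ∃ t, IsOrdinalIn t ∧ e t = x := by
  obtain ⟨e, he, h⟩ := exists_enumeration (M := M) operation DF.operation
  refine ⟨e, he, fun x hx => ?_⟩
  have hW : ClosedUnderOperation {x : M | ∃ t, IsOrdinalIn t ∧ e t = x} := by
    refine ⟨fun d a hd ha => ⟨_, _, _, h d a a a hd ha ha ha⟩, ?_⟩
    rintro d _ _ _ hd ⟨a, ha, rfl⟩ ⟨b, hb, rfl⟩ ⟨c, hc, rfl⟩
    exact ⟨a, h d a b c hd ha hb hc⟩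
  exact hW.mem_of_definable hx

end Satisfaction

/-! ### The omitting types theorem -/

section OmittingTypes

variable {L : FirstOrder.Language.{0, 0}}

theorem realize_congr_of_freeVarFinset {M : Type u} [L.Structure M] {α : Type} [DecidableEq α]
    {n : ℕ} (φ : L.BoundedFormula α n) {v w : α → M} {xs : Fin n → M}
    (h : ∀ i ∈ φ.freeVarFinset, v i = w i) : φ.Realize v xs ↔ φ.Realize w xs := by
  have h₁ := BoundedFormula.realize_restrictFreeVar (φ := φ) (f := id) (v := fun i => w i.1)
    (xs := xs) v fun i => (h i i.2).symm
  exact h₁.symm.trans (BoundedFormula.realize_restrictFreeVar w fun _ => rfl)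

variable (L) in
/-- The formulas that are satisfiable in `M`, ordered by implication in `M`. -/
def SatisfiableFormula (M : Type u) [L.Structure M] : Type :=
  {φ : L.Formula ℕ // ∃ v : ℕ → M, φ.Realize v}

variable {M : Type u} [L.Structure M]

/-- Larger means stronger, so the ideals of this order are the coherent families of conditions. -/
instance : Preorder (SatisfiableFormula L M) where
  le φ ψ := ∀ v : ℕ → M, ψ.1.Realize v → φ.1.Realize v
  le_refl _ _ h := h
  le_trans _ _ _ h₁ h₂ v hv := h₁ v (h₂ v hv)

/-- The conditions that decide the formula `ψ`. -/
def decideCofinal (ψ : L.Formula ℕ) : Order.Cofinal (SatisfiableFormula L M) where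
  carrier := {p | (∀ v : ℕ → M, p.1.Realize v → ψ.Realize v) ∨
    ∀ v : ℕ → M, p.1.Realize v → ¬ ψ.Realize v}
  isCofinal := by
    rintro ⟨φ, v, hv⟩
    by_cases h : ψ.Realize v
    · exact ⟨⟨φ ⊓ ψ, v, Formula.realize_inf.2 ⟨hv, h⟩⟩,
        Or.inl fun w hw => (Formula.realize_inf.1 hw).2, fun w hw => (Formula.realize_inf.1 hw).1⟩
    · refine ⟨⟨φ ⊓ ψ.not, v, Formula.realize_inf.2 ⟨hv, Formula.realize_not.2 h⟩⟩,
        Or.inr fun w hw => Formula.realize_not.1 (Formula.realize_inf.1 hw).2,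
        fun w hw => (Formula.realize_inf.1 hw).1⟩

/-- The conditions that refute the existence of a witness for `ψ` or name one. -/
def witnessCofinal (ψ : L.Formula (ℕ ⊕ Unit)) : Order.Cofinal (SatisfiableFormula L M) where
  carrier := {p | (∀ v : ℕ → M, p.1.Realize v → ∀ x, ¬ ψ.Realize (Sum.elim v fun _ => x)) ∨
    ∃ k, ∀ v : ℕ → M, p.1.Realize v → ψ.Realize (Sum.elim v fun _ => v k)}
  isCofinal := by
    classical
    rintro ⟨φ, v, hv⟩
    by_cases h : ∃ (v : ℕ → M) (x : M), φ.Realize v ∧ ψ.Realize (Sum.elim v fun _ => x)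
    · obtain ⟨v, x, hv, hx⟩ := h
      -- A variable free in neither formula can be made to name the witness.
      obtain ⟨k, hk⟩ := Infinite.exists_notMem_finset
        (φ.freeVarFinset ∪ ψ.freeVarFinset.preimage Sum.inl Sum.inl_injective.injOn)
      rw [Finset.mem_union, not_or, Finset.mem_preimage] at hk
      have h1 : φ.Realize (Function.update v k x) := by
        refine (realize_congr_of_freeVarFinset φ fun i hi => ?_).1 hv
        rw [Function.update_of_ne (by rintro rfl; exact hk.1 hi)]
      have h2 : ψ.Realize (Sum.elim (Function.update v k x) fun _ => x) := by
        refine (realize_congr_of_freeVarFinset ψ ?_).1 hx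
        rintro (i | i) hi
        · simp only [Sum.elim_inl]
          rw [Function.update_of_ne (by rintro rfl; exact hk.2 hi)]
        · rfl
      have h3 : ∀ w : ℕ → M, (ψ.relabel (Sum.elim id fun _ => k)).Realize w ↔
          ψ.Realize (Sum.elim w fun _ => w k) := by
        intro w
        rw [Formula.realize_relabel]
        apply iff_of_eq; congr 1
        ext (i | i) <;> rfl
      refine ⟨⟨φ ⊓ ψ.relabel (Sum.elim id fun _ => k), Function.update v k x,
        Formula.realize_inf.2 ⟨h1, (h3 _).2 ?_⟩⟩, Or.inr ⟨k, fun w hw => ?_⟩,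
        fun w hw => (Formula.realize_inf.1 hw).1⟩
      · rwa [Function.update_self]
      · exact (h3 w).1 (Formula.realize_inf.1 hw).2
    · push Not at h
      exact ⟨⟨φ, v, hv⟩, Or.inl fun w hw x => h w x hw, le_rfl⟩

/-- The conditions by which the variable `n` does not realize the type `q`. -/
def omitCofinal (q : Set (L.Formula (Fin 1)))
    (hq : ∀ θ : L.Formula (Fin 1), (∃ x : Fin 1 → M, θ.Realize x) →
      ∃ φ ∈ q, ∃ x : Fin 1 → M, θ.Realize x ∧ ¬ φ.Realize x) (n : ℕ) :
    Order.Cofinal (SatisfiableFormula L M) where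
  carrier := {p | ∃ φ ∈ q, ∀ v : ℕ → M, p.1.Realize v → ¬ φ.Realize fun _ => v n}
  isCofinal := by
    classical
    rintro ⟨φ, v, hv⟩
    let g : φ.freeVarFinset → Fin 1 ⊕ φ.freeVarFinset :=
      fun i => if i.1 = n then Sum.inl 0 else Sum.inr i
    -- What the condition says about variable `n` alone, all other free variables being projected
    -- away; non-isolation is applied to this formula.
    let θ : L.Formula (Fin 1) := Formula.iExs φ.freeVarFinset (φ.restrictFreeVar g)
    have hθ : ∀ x : Fin 1 → M, θ.Realize x ↔ ∃ v : ℕ → M, v n = x 0 ∧ φ.Realize v := by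
      intro x
      rw [Formula.realize_iExs]
      constructor
      · rintro ⟨w, hw⟩
        refine ⟨fun i => if i = n then x 0 else if h : i ∈ φ.freeVarFinset then w ⟨i, h⟩ else x 0,
          by simp, ?_⟩
        refine (BoundedFormula.realize_restrictFreeVar _ fun i => ?_).1 hw
        by_cases h : i.1 = n
        · simp [g, h]
        · simp [g, h]
      · rintro ⟨w, hw, hφ⟩
        refine ⟨fun i => w i, (BoundedFormula.realize_restrictFreeVar w fun i => ?_).2 hφ⟩
        by_cases h : i.1 = n
        · simp [g, h, hw]
        · simp [g, h]
    obtain ⟨ψ, hψ, x, hx, hxψ⟩ := hq θ ⟨fun _ => v n, (hθ _).2 ⟨v, rfl, hv⟩⟩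
    obtain ⟨w, hw, hwφ⟩ := (hθ x).1 hx
    have h3 : ∀ w : ℕ → M, (ψ.relabel fun _ => n).Realize w ↔ ψ.Realize fun _ => w n := fun w =>
      Formula.realize_relabel
    have hxw : x = fun _ => w n := by
      ext i
      rw [Subsingleton.elim i 0, hw]
    refine ⟨⟨φ ⊓ (ψ.relabel fun _ => n).not, w, Formula.realize_inf.2 ⟨hwφ, ?_⟩⟩,
      ⟨ψ, hψ, fun w hw => ?_⟩, fun w hw => (Formula.realize_inf.1 hw).1⟩
    · rw [Formula.realize_not, h3, ← hxw]
      exact hxψ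
    · have := (Formula.realize_inf.1 hw).2
      rwa [Formula.realize_not, h3] at this

/-- A form of compactness: a finitely satisfiable set of formulas is satisfied by an assignment. -/
theorem exists_realize_of_finitely [Nonempty M] (Γ : Set (L.Formula ℕ))
    (h : ∀ s : Finset (L.Formula ℕ), ↑s ⊆ Γ → ∃ v : ℕ → M, ∀ φ ∈ s, φ.Realize v) :
    ∃ (N : Type) (_ : L.Structure N) (w : ℕ → N), ∀ φ ∈ Γ, φ.Realize w := by
  classical
  -- The variables become constants, so that compactness for sentences applies.
  have hsat : Theory.IsSatisfiable ((Formula.equivSentence '' Γ : Set L[[ℕ]].Sentence) :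
      L[[ℕ]].Theory) := by
    rw [Theory.isSatisfiable_iff_isFinitelySatisfiable]
    intro T0 hT0
    obtain ⟨v, hv⟩ := h (T0.image Formula.equivSentence.symm) (by
      intro φ hφ
      obtain ⟨σ, hσ, rfl⟩ := Finset.mem_image.1 (Finset.mem_coe.1 hφ)
      obtain ⟨φ, hφ, rfl⟩ := hT0 (Finset.mem_coe.2 hσ)
      rwa [Equiv.symm_apply_apply])
    let _ := constantsOn.structure v
    have : M ⊨ (T0 : L[[ℕ]].Theory) := by
      refine ⟨fun σ hσ => ?_⟩
      exact (Formula.realize_equivSentence_symm M σ v).1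
        (hv _ (Finset.mem_image_of_mem _ (Finset.mem_coe.1 hσ)))
    exact Theory.Model.isSatisfiable M
  obtain ⟨N⟩ := hsat
  let _ : L.Structure N := (L.lhomWithConstants ℕ).reduct N
  have : (L.lhomWithConstants ℕ).IsExpansionOn N := LHom.isExpansionOn_reduct _ _
  refine ⟨N, inferInstance, fun i => (L.con i : N), fun φ hφ => ?_⟩
  exact (Formula.realize_equivSentence N φ).1
    (Theory.realize_sentence_of_mem _ (Set.mem_image_of_mem _ hφ))

/-- The omitting types theorem, for countably many types none of which is isolated in `M`. -/
theorem exists_elementarilyEquivalent_omitting [L.IsRelational] [Countable L.Symbols]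
    [Nonempty M] (q : ℕ → Set (L.Formula (Fin 1)))
    (hq : ∀ k, ∀ θ : L.Formula (Fin 1), (∃ x : Fin 1 → M, θ.Realize x) →
      ∃ φ ∈ q k, ∃ x : Fin 1 → M, θ.Realize x ∧ ¬ φ.Realize x) :
    ∃ (N : Type u) (_ : L.Structure N), (M ≅[L] N) ∧
      ∀ k (y : Fin 1 → N), ∃ φ ∈ q k, ¬ φ.Realize y := by
  let ι := L.Formula ℕ ⊕ L.Formula (ℕ ⊕ Unit) ⊕ ℕ × ℕ
  let _ : Encodable ι := Encodable.ofCountable ι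
  let D : ι → Order.Cofinal (SatisfiableFormula L M) :=
    Sum.elim decideCofinal (Sum.elim witnessCofinal fun kn => omitCofinal (q kn.1) (hq kn.1) kn.2)
  let p₀ : SatisfiableFormula L M := ⟨⊤, fun _ => Classical.arbitrary M, by simp⟩
  -- A generic ideal meeting the countably many cofinal sets; the formulas it forces make up `Γ`.
  let I := Order.idealOfCofinals p₀ D
  have hI : ∀ i, ∃ p, p ∈ D i ∧ p ∈ I := Order.cofinal_meets_idealOfCofinals _ D
  let Γ : Set (L.Formula ℕ) := {ψ | ∃ p ∈ I, ∀ v : ℕ → M, p.1.Realize v → ψ.Realize v}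
  have hdec : ∀ ψ, ψ ∈ Γ ∨ ψ.not ∈ Γ := by
    intro ψ
    obtain ⟨p, hp | hp, hpI⟩ := hI (Sum.inl ψ)
    · exact Or.inl ⟨p, hpI, hp⟩
    · exact Or.inr ⟨p, hpI, fun v hv => Formula.realize_not.2 (hp v hv)⟩
  have hfin : ∀ s : Finset (L.Formula ℕ), ↑s ⊆ Γ →
      ∃ p ∈ I, ∀ v : ℕ → M, p.1.Realize v → ∀ φ ∈ s, φ.Realize v := by
    classical
    intro s
    induction s using Finset.induction_on with
    | empty => exact fun _ => ⟨p₀, Order.mem_idealOfCofinals _ D, by simp⟩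
    | insert φ s _ ih =>
      intro hs
      rw [Finset.coe_insert, Set.insert_subset_iff] at hs
      obtain ⟨p, hp, hpφ⟩ := hs.1
      obtain ⟨r, hr, hrs⟩ := ih hs.2
      obtain ⟨t, ht, hpt, hrt⟩ := I.directed p hp r hr
      refine ⟨t, ht, fun v hv ψ hψ => ?_⟩
      rcases Finset.mem_insert.1 hψ with rfl | hψ
      · exact hpφ v (hpt v hv)
      · exact hrs v (hrt v hv) ψ hψ
  obtain ⟨N, _, w, hw⟩ := exists_realize_of_finitely Γ fun s hs => by
    obtain ⟨p, -, h⟩ := hfin s hs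
    exact p.2.imp h
  have hMN : M ≅[L] N := by
    rw [elementarilyEquivalent_iff]
    have key : ∀ σ : L.Sentence, M ⊨ σ → N ⊨ σ := by
      intro σ hσ
      have hreal : ∀ {K : Type _} [L.Structure K] (v : ℕ → K),
          (σ.relabel (Empty.elim : Empty → ℕ)).Realize v ↔ K ⊨ σ := by
        intro K _ v
        rw [Formula.realize_relabel]
        apply iff_of_eq
        rw [Sentence.Realize]
        congr 1
        exact Subsingleton.elim _ _
      rcases hdec (σ.relabel (Empty.elim : Empty → ℕ)) with h | ⟨p, -, hp⟩
      · have := hw _ h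
        rw [Formula.realize_relabel] at this
        rw [Sentence.Realize]
        convert this
      · obtain ⟨v, hv⟩ := p.2
        exact absurd ((hreal v).2 hσ) (Formula.realize_not.1 (hp v hv))
    refine fun σ => ⟨key σ, fun hN => ?_⟩
    by_contra hM
    exact (Sentence.realize_not N).1 (key _ ((Sentence.realize_not M).2 hM)) hN
  -- Types are omitted only by the elements that variables name. These form an elementary
  -- substructure by the Tarski–Vaught test, whose witnesses come from `witnessCofinal`.
  let S : L.Substructure N := ⟨Set.range w, fun f => isEmptyElim f⟩
  have hS : S.IsElementary := by
    refine S.isElementary_of_exists fun n φ x a hφ => ?_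
    choose k hk using fun i => (x i).2
    let ψ : L.Formula (ℕ ⊕ Unit) := φ.toFormula.relabel
      (Sum.elim Empty.elim (Fin.snoc (fun i => Sum.inl (k i)) (Sum.inr ())))
    have hψ : ∀ b, ψ.Realize (Sum.elim w fun _ => b) ↔
        φ.Realize default (Fin.snoc ((↑) ∘ x) b : Fin (n + 1) → N) := by
      intro b
      rw [Formula.realize_relabel, BoundedFormula.realize_toFormula]
      apply iff_of_eq
      congr 1
      · exact Subsingleton.elim _ _
      · ext i
        refine Fin.lastCases ?_ (fun i => ?_) i
        · simp
        · simpa using hk i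
    obtain ⟨p, hp, hpI⟩ := hI (Sum.inr (Sum.inl ψ))
    rcases hp with hp | ⟨j, hj⟩
    · have h1 : (ψ.iExs Unit).not ∈ Γ := by
        refine ⟨p, hpI, fun v hv => ?_⟩
        rw [Formula.realize_not, Formula.realize_iExs]
        rintro ⟨y, hy⟩
        exact hp v hv (y ()) hy
      have h2 := hw _ h1
      rw [Formula.realize_not, Formula.realize_iExs] at h2
      exact absurd ⟨fun _ => a, (hψ a).2 hφ⟩ h2
    · have hcomp : ∀ {K : Type u} (v : ℕ → K),
          v ∘ (Sum.elim id fun _ : Unit => j) = Sum.elim v fun _ => v j := by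
        intro K v
        ext (i | i) <;> rfl
      have h1 : ψ.relabel (Sum.elim id fun _ => j) ∈ Γ :=
        ⟨p, hpI, fun v hv => by rw [Formula.realize_relabel, hcomp]; exact hj v hv⟩
      have h2 := hw _ h1
      rw [Formula.realize_relabel] at h2
      refine ⟨⟨w j, j, rfl⟩, (hψ (w j)).1 ?_⟩
      convert h2 using 1
      ext (i | i) <;> rfl
  -- The structure obtained from compactness lives in `Type` and is lifted to the universe of `M`.
  let e : S ≃ ULift.{u} S := Equiv.ulift.symm
  let _ : L.Structure (ULift.{u} S) := e.inducedStructure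
  let g : S ≃[L] ULift.{u} S := e.inducedStructureEquiv
  refine ⟨ULift.{u} S, inferInstance, ?_, fun k y => ?_⟩
  · have h1 : S ≅[L] N := (⟨S, hS⟩ : L.ElementarySubstructure N).elementarilyEquivalent
    have h2 : S ≅[L] ULift.{u} S := StrongHomClass.elementarilyEquivalent g
    exact hMN.trans (h1.symm.trans h2)
  · obtain ⟨n, hn⟩ := (y 0).down.2
    obtain ⟨p, ⟨φ, hφ, hp⟩, hpI⟩ := hI (Sum.inr (Sum.inr (k, n)))
    have h1 : (φ.relabel fun _ => n).not ∈ Γ := ⟨p, hpI, fun v hv => by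
      rw [Formula.realize_not, Formula.realize_relabel]
      exact hp v hv⟩
    have h2 := hw _ h1
    rw [Formula.realize_not, Formula.realize_relabel] at h2
    refine ⟨φ, hφ, fun h3 => h2 ?_⟩
    have h4 : φ.Realize fun i => (y i).down :=
      (StrongHomClass.realize_formula g φ (v := fun i => (y i).down)).1 h3
    have h5 := (hS φ fun i => (y i).down).2 h4
    convert h5 using 1
    ext i
    rw [Subsingleton.elim i 0]
    exact hn

end OmittingTypes

/-! ### Sentences that carry the properties to other models -/

section Transfer

/-- The formula saying that its free variable is an ordinal. -/
def ordinalFormula : LSet.Formula (Fin 1) :=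
  let x : ∀ {n : ℕ}, LSet.Term (Fin 1 ⊕ Fin n) := Term.var (Sum.inl 0)
  (∀' (mem (&0) x ⟹ ∀' (mem (&1) (&0) ⟹ mem (&1) x))) ⊓
  (∀' (mem (&0) x ⟹ ∼(mem (&0) (&0)))) ⊓
  (∀' (mem (&0) x ⟹ ∀' (mem (&1) x ⟹ ∀' (mem (&2) x ⟹
    mem (&0) (&1) ⟹ mem (&1) (&2) ⟹ mem (&0) (&2))))) ⊓
  (∀' (mem (&0) x ⟹ ∀' (mem (&1) x ⟹ (mem (&0) (&1) ⊔ ((&0 =' &1) ⊔ mem (&1) (&0)))))) ⊓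
  (∀' ((∀' (mem (&1) (&0) ⟹ mem (&1) x)) ⟹ (∃' mem (&1) (&0)) ⟹
    ∃' (mem (&1) (&0) ⊓ ∀' (mem (&2) (&0) ⟹ ((&1 =' &2) ⊔ mem (&1) (&2))))))

theorem realize_ordinalFormula {M : Type u} [LSet.Structure M] (v : Fin 1 → M) :
    ordinalFormula.Realize v ↔ IsOrdinalIn (v 0) := by
  simp [ordinalFormula, Formula.Realize, IsOrdinalIn, Fin.snoc, and_assoc]

/-- The formula saying that its free variable is the only element satisfying `ψ`. -/
noncomputable def uniqueFormula (ψ : LSet.Formula (Fin 1)) : LSet.Formula (Fin 1) :=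
  ψ ⊓ Formula.iAlls (Fin 1) ((ψ.relabel Sum.inr).imp
    (Term.equal (.var (.inr 0)) (.var (.inl 0))))

theorem realize_uniqueFormula {M : Type u} [LSet.Structure M] (ψ : LSet.Formula (Fin 1))
    (x : Fin 1 → M) :
    (uniqueFormula ψ).Realize x ↔ ∀ y : Fin 1 → M, ψ.Realize y ↔ y 0 = x 0 := by
  rw [uniqueFormula, Formula.realize_inf, Formula.realize_iAlls]
  have key : ∀ y : Fin 1 → M, ((ψ.relabel Sum.inr).imp
      (Term.equal (.var (.inr 0)) (.var (.inl 0))) : LSet.Formula (Fin 1 ⊕ Fin 1)).Realize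
        (Sum.elim x y) ↔ (ψ.Realize y → y 0 = x 0) := fun y => by
    rw [Formula.realize_imp, Formula.realize_relabel, Formula.realize_equal]
    rfl
  simp only [key]
  constructor
  · rintro ⟨hx, h⟩ y
    refine ⟨h y, fun hy => ?_⟩
    have : y = x := funext fun i => by rw [Subsingleton.elim i 0, hy]
    rwa [this]
  · exact fun h => ⟨(h x).2 rfl, fun y => (h y).1⟩


/-- The sentence saying that every element is the value at some ordinal of the partial function
whose graph is defined by `χ`. -/
noncomputable def enumerationSentence (χ : LSet.Formula (Option (Fin 1))) : LSet.Sentence :=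
  univClosure (n := 1) (Formula.iExs (Fin 1) ((ordinalFormula.relabel Sum.inr) ⊓
    Formula.iAlls (Fin 1) ((χ.relabel fun o => o.elim (Sum.inr 0) fun _ => Sum.inl (Sum.inr 0)).iff
      (Term.equal (.var (.inr 0)) (.var (.inl (.inl 0)))))))

/-- In a model other than the one `χ` comes from, `χ` need not define a function, so uniqueness of
the value is part of what is expressed. -/
theorem realize_enumerationSentence {M : Type u} [LSet.Structure M]
    (χ : LSet.Formula (Option (Fin 1))) : M ⊨ enumerationSentence χ ↔
      ∀ x : M, ∃ t, IsOrdinalIn t ∧ ∀ y, χ.Realize (fun o => o.elim y fun _ => t) ↔ y = x := by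
  have key : ∀ x t y : Fin 1 → M, ((χ.relabel fun o =>
      o.elim (Sum.inr 0) fun _ => Sum.inl (Sum.inr 0)).iff
      (Term.equal (.var (.inr 0)) (.var (.inl (.inl 0)))) :
        LSet.Formula ((Fin 1 ⊕ Fin 1) ⊕ Fin 1)).Realize (Sum.elim (Sum.elim x t) y) ↔
      (χ.Realize (fun o => o.elim (y 0) fun _ => t 0) ↔ y 0 = x 0) := by
    intro x t y
    rw [Formula.realize_iff, Formula.realize_relabel, Formula.realize_equal]
    refine iff_congr (iff_of_eq ?_) Iff.rfl
    congr 1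
    ext o
    cases o <;> rfl
  have key' : ∀ x t : Fin 1 → M, (ordinalFormula.relabel (Sum.inr : Fin 1 → Fin 1 ⊕ Fin 1)).Realize
      (Sum.elim x t) ↔ IsOrdinalIn (t 0) := by
    intro x t
    rw [Formula.realize_relabel, realize_ordinalFormula]
    rfl
  rw [enumerationSentence, realize_univClosure]
  simp only [Formula.realize_iExs, Formula.realize_inf, Formula.realize_iAlls, key, key']
  constructor
  · intro h x
    obtain ⟨t, ht, h1⟩ := h fun _ => x
    exact ⟨t 0, ht, fun y => h1 fun _ => y⟩
  · intro h x
    obtain ⟨t, ht, h1⟩ := h (x 0)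
    exact ⟨fun _ => t, ht, fun y => h1 (y 0)⟩

end Transfer

/-! ### Definable and algebraic elements -/

section Definable

variable {M : Type u} [LSet.Structure M]

theorem definable₁_iff_dfn {s : Set M} :
    (∅ : Set M).Definable₁ LSet s ↔ Dfn (∅ : Set M) (fun v : Fin 1 → M => v 0 ∈ s) := by
  unfold Set.Definable₁
  rw [Set.empty_definable_iff]
  constructor
  · rintro ⟨φ, hφ⟩
    exact (Dfn.of_formula φ).congr fun v => (Set.ext_iff.1 hφ v).symm
  · intro h
    obtain ⟨φ, hφ⟩ := h.exists_formula
    exact ⟨φ, Set.ext hφ⟩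

theorem isDefinableElement_iff_dfn {a : M} :
    IsDefinableElement a ↔ Dfn (∅ : Set M) (fun v : Fin 1 → M => v 0 = a) :=
  definable₁_iff_dfn

theorem IsDefinableElement.const {a : M} (h : IsDefinableElement a) {α : Type} :
    DF (∅ : Set M) (fun _ : α → M => a) :=
  ⟨(isDefinableElement_iff_dfn.1 h).reindex fun _ => none⟩

theorem IsDefinableElement.of_dfn {a : M} {P : M → Prop}
    (hP : Dfn (∅ : Set M) (fun v : Fin 1 → M => P (v 0))) (h : ∀ x, P x ↔ x = a) :
    IsDefinableElement a :=
  isDefinableElement_iff_dfn.2 (hP.congr fun v => h (v 0))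

/-- Elementarily equivalent structures all of whose elements are definable are isomorphic. -/
theorem nonempty_equiv_of_definable {N : Type u} [LSet.Structure N] (hMN : M ≅[LSet] N)
    (hM : ∀ a : M, IsDefinableElement a) (hN : ∀ a : N, IsDefinableElement a) :
    Nonempty (M ≃[LSet] N) := by
  choose φ hφ using fun a => (isDefinableElement_iff_dfn.1 (hM a)).exists_formula
  have hex : ∀ ψ : LSet.Formula (Fin 1), (∃ v : Fin 1 → M, ψ.Realize v) ↔
      ∃ v : Fin 1 → N, ψ.Realize v := by
    intro ψ
    have := hMN.realize_sentence (univClosure ψ.not)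
    rw [realize_univClosure, realize_univClosure] at this
    simpa using not_congr this
  choose f hf using fun a => (hex (φ a)).1 ⟨fun _ => a, (hφ a _).1 rfl⟩
  have key : ∀ {n : ℕ} (θ : LSet.Formula (Fin n)) (a : Fin n → M), θ.Realize a →
      θ.Realize fun i => f (a i) 0 := by
    intro n θ a ha
    -- This sentence holds in `M`, because only the tuple `a` satisfies all the defining formulas of
    -- its entries.
    have := hMN.realize_sentence (univClosure
      ((Formula.iInf fun i => (φ (a i)).relabel fun _ : Fin 1 => i).imp θ))
    rw [realize_univClosure, realize_univClosure] at this
    simp only [Formula.realize_imp, Formula.realize_iInf, Formula.realize_relabel] at this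
    refine this.1 (fun v hv => ?_) _ fun i => ?_
    · have : v = a := funext fun i => (hφ (a i) _).2 (hv i)
      exact this ▸ ha
    · convert hf (a i) using 1
      ext j
      rw [Subsingleton.elim j 0]
      rfl
  have key' : ∀ {n : ℕ} (θ : LSet.Formula (Fin n)) (a : Fin n → M),
      (θ.Realize fun i => f (a i) 0) ↔ θ.Realize a := by
    refine fun θ a => ⟨fun h => ?_, key θ a⟩
    by_contra hn
    exact Formula.realize_not.1 (key θ.not a (Formula.realize_not.2 hn)) h
  have hbij : Function.Bijective fun a => f a 0 := by
    constructor
    · intro a b hab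
      have := (key' (Term.equal (.var 0) (.var 1)) ![a, b]).1 (Formula.realize_equal.2 hab)
      exact Formula.realize_equal.1 this
    · intro c
      obtain ⟨ψ, hψ⟩ := (isDefinableElement_iff_dfn.1 (hN c)).exists_formula
      obtain ⟨v, hv⟩ := (hex ψ).2 ⟨fun _ => c, (hψ _).1 rfl⟩
      exact ⟨v 0, (hψ fun i => f (v i) 0).2 (key ψ v hv)⟩
  refine ⟨⟨Equiv.ofBijective _ hbij, fun g => Empty.elim g, fun {n} r x => ?_⟩⟩
  have := key' (r.formula fun i => Term.var i) x
  rwa [Formula.realize_rel, Formula.realize_rel] at this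

/-- The least element is definable; removing it leaves a smaller definable set. -/
theorem isDefinableElement_of_finite [ZFModel M] {s : Set M} (hs : s.Finite)
    (hdef : Dfn (∅ : Set M) (fun v : Fin 1 → M => v 0 ∈ s)) (hord : ∀ a ∈ s, IsOrdinalIn a)
    {a : M} (ha : a ∈ s) : IsDefinableElement a := by
  induction hn : s.ncard using Nat.strong_induction_on generalizing s with
  | _ n ih =>
    have := hdef.mono (Set.empty_subset Set.univ)
    obtain ⟨m, hmo, hms, hmin⟩ := exists_least_ordinal (fun x => x ∈ s) (hord a ha) ha
    have hm : IsDefinableElement m := by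
      have hs' {β : Type} {f : (β → M) → M} [hf : DF (∅ : Set M) f] :
        Dfn (∅ : Set M) (fun v => f v ∈ s) := Dfn.comp1 (R := fun x => x ∈ s) hdef hf
      refine IsDefinableElement.of_dfn (P := fun x => x ∈ s ∧ ∀ y, E y x → ¬ y ∈ s)
        inferInstance fun x => ⟨fun ⟨hx, hxmin⟩ => ?_, ?_⟩
      · rcases hmo.trichotomy (hord x hx) with h | h | h
        · exact absurd hms (hxmin m h)
        · exact h.symm
        · exact absurd hx (hmin x h)
      · rintro rfl
        exact ⟨hms, hmin⟩
    by_cases ham : a = m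
    · exact ham ▸ hm
    · have hmc : DF (∅ : Set M) (fun _ : Fin 1 → M => m) := hm.const
      refine ih (s \ {m}).ncard (hn ▸ Set.ncard_sdiff_singleton_lt_of_mem hms hs)
        hs.sdiff ?_ (fun x hx => hord x hx.1) ⟨ha, ham⟩ rfl
      exact (inferInstance : Dfn (∅ : Set M) fun v : Fin 1 → M => v 0 ∈ s ∧ ¬ v 0 = m)

theorem PointwiseAlgebraic.ordinalsDefinable [ZFModel M] (h : PointwiseAlgebraic M) :
    OrdinalsDefinable M := by
  intro x hx
  obtain ⟨s, hs, hfin, hxs⟩ := h x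
  have hs' := definable₁_iff_dfn.1 hs
  refine isDefinableElement_of_finite (hfin.subset Set.inter_subset_left)
    (s := s ∩ {y | IsOrdinalIn y}) ?_ (fun a ha => ha.2) ⟨hxs, hx⟩
  exact (inferInstance : Dfn (∅ : Set M) fun v : Fin 1 → M => v 0 ∈ s ∧ IsOrdinalIn (v 0))

end Definable

instance : LSet.IsRelational := fun _ => inferInstanceAs (IsEmpty Empty)

instance : Countable LSet.Symbols := by
  have h1 : ∀ n, Countable (LSet.Functions n) := fun _ => inferInstanceAs (Countable Empty)
  have h2 : ∀ n, Countable (LSet.Relations n) := fun n =>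
    have : Subsingleton (MemRel n) := ⟨fun a b => by cases a; cases b; rfl⟩
    inferInstanceAs (Countable (MemRel n))
  exact inferInstanceAs (Countable ((Σ n, LSet.Functions n) ⊕ Σ n, LSet.Relations n))

/-! ### The range of a definable enumeration -/

section OrdinalRange

variable {M : Type u} [LSet.Structure M]

/-- The values of `e` at ordinals. -/
def ordinalRange (e : M → M) : Set M := {x | ∃ t, IsOrdinalIn t ∧ e t = x}

variable {e : M → M} (he : DF (∅ : Set M) (fun v : Fin 1 → M => e (v 0)))
include he

theorem dfn_ordinalRange : Dfn (∅ : Set M) (fun v : Fin 1 → M => v 0 ∈ ordinalRange e) := by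
  have he' {β : Type} {f : (β → M) → M} [hf : DF (∅ : Set M) f] :
    DF (∅ : Set M) (fun v => e (f v)) := he.comp1 hf
  exact (inferInstance : Dfn (∅ : Set M) fun v : Fin 1 → M =>
    ∃ t, IsOrdinalIn t ∧ e t = v 0)

theorem isDefinableElement_of_mem_ordinalRange (hM : OrdinalsDefinable M) {x : M}
    (hx : x ∈ ordinalRange e) : IsDefinableElement x := by
  obtain ⟨t, ht, rfl⟩ := hx
  have h : DF (∅ : Set M) (fun _ : Fin 1 → M => e t) := he.comp1 (hM t ht).const
  exact IsDefinableElement.of_dfn (P := fun y => y = e t) inferInstance fun _ => Iff.rfl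

end OrdinalRange

/-! ### Types to be omitted, and sets of enumerated elements -/

section Model

variable {M : Type u} [LSet.Structure M] [ZFModel M]

/-- The formulas that hold of an ordinal that is not definable. -/
def undefinableOrdinalType : Set (LSet.Formula (Fin 1)) :=
  insert ordinalFormula (Set.range fun ψ => (uniqueFormula ψ).not)

/-- Either some non-ordinal satisfies `θ`, or the least ordinal satisfying `θ` is definable; each
violates a formula of the type. -/
theorem undefinableOrdinalType_not_isolated (θ : LSet.Formula (Fin 1))
    (hθ : ∃ x : Fin 1 → M, θ.Realize x) :
    ∃ φ ∈ undefinableOrdinalType, ∃ x : Fin 1 → M, θ.Realize x ∧ ¬ φ.Realize x := by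
  obtain ⟨x, hx⟩ := hθ
  by_cases hord : ∀ y : Fin 1 → M, θ.Realize y → IsOrdinalIn (y 0)
  · have hd (A : Set M) : Dfn A (fun v : Fin 1 → M => θ.Realize fun _ => v 0) :=
      (Dfn.of_formula θ).congr fun v => by
        rw [show v = fun _ => v 0 from funext fun i => congrArg v (Subsingleton.elim i 0)]
    have := hd Set.univ
    have hx' : θ.Realize fun _ => x 0 := by
      rwa [show (fun _ => x 0) = x from funext fun i => congrArg x (Subsingleton.elim 0 i)]
    obtain ⟨m, hm, hmθ, hmin⟩ := exists_least_ordinal (fun a => θ.Realize fun _ => a)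
      (hord x hx) hx'
    have hc {β : Type} {f : (β → M) → M} [hf : DF (∅ : Set M) f] :
      Dfn (∅ : Set M) (fun v => θ.Realize fun _ => f v) :=
        Dfn.comp1 (R := fun a => θ.Realize fun _ => a) (hd ∅) hf
    have hdef : IsDefinableElement m := by
      refine IsDefinableElement.of_dfn (P := fun a => (θ.Realize fun _ => a) ∧
        ∀ b, E b a → ¬ θ.Realize fun _ => b) inferInstance fun a => ⟨fun ⟨ha, hamin⟩ => ?_, ?_⟩
      · rcases hm.trichotomy (hord _ ha) with h | h | h
        · exact absurd hmθ (hamin m h)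
        · exact h.symm
        · exact absurd ha (hmin a h)
      · rintro rfl
        exact ⟨hmθ, hmin⟩
    obtain ⟨ψ, hψ⟩ := (isDefinableElement_iff_dfn.1 hdef).exists_formula
    refine ⟨_, Or.inr ⟨ψ, rfl⟩, fun _ => m, hmθ, ?_⟩
    rw [Formula.realize_not, not_not, realize_uniqueFormula]
    exact fun y => (hψ y).symm
  · push Not at hord
    obtain ⟨y, hy, hyo⟩ := hord
    exact ⟨_, Or.inl rfl, y, hy, fun h => hyo ((realize_ordinalFormula y).1 h)⟩

theorem isDefinableElement_of_omits {N : Type u} [LSet.Structure N] {x : N} (hx : IsOrdinalIn x)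
    (h : ∃ φ ∈ undefinableOrdinalType, ¬ φ.Realize fun _ : Fin 1 => x) : IsDefinableElement x := by
  obtain ⟨φ, rfl | ⟨ψ, rfl⟩, hφ⟩ := h
  · exact absurd ((realize_ordinalFormula _).2 hx) hφ
  · rw [Formula.realize_not, not_not, realize_uniqueFormula] at hφ
    exact isDefinableElement_iff_dfn.2 ((Dfn.of_formula ψ).congr hφ)

variable {e : M → M} (he : DF (∅ : Set M) (fun v : Fin 1 → M => e (v 0)))
include he

theorem exists_minimal_notMem_ordinalRange (h : ∃ x, x ∉ ordinalRange e) :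
    ∃ x, x ∉ ordinalRange e ∧ ∀ y, E y x → y ∈ ordinalRange e := by
  have := (dfn_ordinalRange he).mono (Set.empty_subset Set.univ)
  obtain ⟨x, hx⟩ := h
  obtain ⟨m, hm, hmin⟩ := exists_minimal (fun x => ¬ x ∈ ordinalRange e) hx
  exact ⟨m, hm, fun y hy => not_not.1 (hmin y hy)⟩

/-- A set of elements of `ordinalRange e` is distinguished from each other element by a definable
property. -/
theorem exists_dfn_separating (hM : OrdinalsDefinable M) {x y : M} (hxy : y ≠ x)
    (hx : ∀ z, E z x → z ∈ ordinalRange e) :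
    ∃ Q : M → Prop, Dfn (∅ : Set M) (fun v : Fin 1 → M => Q (v 0)) ∧ Q x ∧ ¬ Q y := by
  have hr := dfn_ordinalRange he
  have hr' {β : Type} {f : (β → M) → M} [hf : DF (∅ : Set M) f] :
    Dfn (∅ : Set M) (fun v => f v ∈ ordinalRange e) :=
      Dfn.comp1 (R := fun a => a ∈ ordinalRange e) hr hf
  by_cases hy : ∀ z, E z y → z ∈ ordinalRange e
  · have hne : ∃ z, ¬ (E z y ↔ E z x) := by
      by_contra! h
      exact hxy (ext h)
    obtain ⟨z, hz⟩ := hne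
    -- An element on which `x` and `y` differ lies in one of them, so it is enumerated and hence
    -- definable.
    have hzr : z ∈ ordinalRange e := by
      by_cases h : E z x
      · exact hx z h
      · exact hy z (by tauto)
    have hzc {α : Type} : DF (∅ : Set M) (fun _ : α → M => z) :=
      (isDefinableElement_of_mem_ordinalRange he hM hzr).const
    by_cases h : E z x
    · exact ⟨fun u => E z u, inferInstance, h, by tauto⟩
    · exact ⟨fun u => ¬ E z u, inferInstance, h, by tauto⟩
  · exact ⟨fun u => ∀ z, E z u → z ∈ ordinalRange e, inferInstance, hx, hy⟩

/-- Only finitely many rivals share the finite definable set with `x`, so the conjunction of their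
separating properties is still one formula. -/
theorem PointwiseAlgebraic.isDefinableElement_of_sub (hM : PointwiseAlgebraic M) {x : M}
    (hx : ∀ z, E z x → z ∈ ordinalRange e) : IsDefinableElement x := by
  obtain ⟨s, hs, hfin, hxs⟩ := hM x
  have hsd := definable₁_iff_dfn.1 hs
  have : Finite ↥(s \ {x}) := hfin.sdiff
  choose Q hQ hQx hQy using fun y : ↥(s \ {x}) =>
    exists_dfn_separating he hM.ordinalsDefinable y.2.2 hx
  have hall : Dfn (∅ : Set M) (fun v : Fin 1 → M => ∀ y, Q y (v 0)) := Dfn.forall_of_finite hQ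
  refine IsDefinableElement.of_dfn (P := fun a => a ∈ s ∧ ∀ y, Q y a) inferInstance
    fun a => ⟨fun ⟨ha, haQ⟩ => ?_, ?_⟩
  · by_contra hax
    exact hQy ⟨a, ha, hax⟩ (haQ _)
  · rintro rfl
    exact ⟨hxs, hQx⟩

/-- If the type of a set of elements of `ordinalRange e` is isolated, the set is definable. -/
theorem isDefinableElement_of_isolated (hM : OrdinalsDefinable M) {x : M}
    (hx : ∀ z, E z x → z ∈ ordinalRange e) {θ : LSet.Formula (Fin 1)}
    (hsat : ∃ y : Fin 1 → M, θ.Realize y)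
    (hθ : ∀ φ : LSet.Formula (Fin 1), (φ.Realize fun _ => x) →
      ∀ y : Fin 1 → M, θ.Realize y → φ.Realize y) : IsDefinableElement x := by
  have hunique : ∀ y : Fin 1 → M, θ.Realize y → y 0 = x := by
    intro y hy
    by_contra hne
    obtain ⟨Q, hQ, hQx, hQy⟩ := exists_dfn_separating he hM hne hx
    obtain ⟨φ, hφ⟩ := hQ.exists_formula
    exact hQy ((hφ y).2 (hθ φ ((hφ _).1 hQx) y hy))
  have hθx : θ.Realize fun _ => x := by
    obtain ⟨y, hy⟩ := hsat
    convert hy using 1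
    ext i
    rw [Subsingleton.elim i 0, hunique y hy]
  refine isDefinableElement_iff_dfn.2 ((Dfn.of_formula θ).congr fun v => ⟨hunique v, fun hv => ?_⟩)
  convert hθx using 1
  ext i
  rw [Subsingleton.elim i 0, hv]

end Model

theorem isDefinableElement_of_realize_enumerationSentence {N : Type u} [LSet.Structure N]
    {χ : LSet.Formula (Option (Fin 1))} (h : N ⊨ enumerationSentence χ)
    (hN : OrdinalsDefinable N) (x : N) : IsDefinableElement x := by
  obtain ⟨t, ht, hx⟩ := (realize_enumerationSentence χ).1 h x
  refine IsDefinableElement.of_dfn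
    (P := fun y => χ.Realize fun o => o.elim y fun _ => t) ?_ hx
  have htc := (hN t ht).const (α := Fin 1)
  refine (Dfn.comp (A := ∅) (Dfn.of_formula χ)
    (f := fun o (v : Fin 1 → N) => o.elim (v 0) fun _ => t) fun o => ?_)
  cases o
  exacts [DF.var 0, htc]

/-- A complete extension of `ZF` has an algebraic model if and only if it has exactly one model
with definable ordinals. -/
theorem exists_pointwiseAlgebraic_iff (T : LSet.Theory) (hcomplete : T.IsComplete)
    (hZF : ExtendsZF T) :
    (∃ M : Theory.ModelType.{0, 0, u} T, PointwiseAlgebraic M) ↔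
      ∃ M : Theory.ModelType.{0, 0, u} T, OrdinalsDefinable M ∧
        ∀ N : Theory.ModelType.{0, 0, u} T, OrdinalsDefinable N →
          Nonempty (N ≃[LSet] M) := by
  have hmodel : ∀ M : Theory.ModelType.{0, 0, u} T, ZFModel M := fun M =>
    ZFModel.of_realize fun σ hσ => (hZF σ hσ).realize_sentence M
  constructor
  · rintro ⟨M, hM⟩
    have := hmodel M
    obtain ⟨e, he, hdef⟩ := exists_enumeration_of_definable (M := M)
    -- A minimal omitted element would be definable, hence enumerated after all.
    have hall : ∀ x, x ∈ ordinalRange e := by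
      by_contra! h
      obtain ⟨x, hx, hmin⟩ := exists_minimal_notMem_ordinalRange he h
      exact hx (hdef x (isDefinableElement_iff_dfn.1 (hM.isDefinableElement_of_sub he hmin)))
    obtain ⟨χ, hχ⟩ := he.out.exists_formula
    have hsent : M ⊨ enumerationSentence χ := by
      refine (realize_enumerationSentence χ).2 fun x => ?_
      obtain ⟨t, ht, rfl⟩ := hall x
      exact ⟨t, ht, fun y => (hχ fun o => o.elim y fun _ => t).symm⟩
    refine ⟨M, hM.ordinalsDefinable, fun N hN => ?_⟩
    have hequiv : N ≅[LSet] M := elementarilyEquivalent_iff.2 fun σ =>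
      (hcomplete.realize_sentence_iff σ N).trans (hcomplete.realize_sentence_iff σ M).symm
    exact nonempty_equiv_of_definable hequiv
      (isDefinableElement_of_realize_enumerationSentence
        ((hequiv.realize_sentence _).2 hsent) hN)
      (isDefinableElement_of_realize_enumerationSentence hsent hM.ordinalsDefinable)
  · rintro ⟨M, hM, hunique⟩
    have := hmodel M
    obtain ⟨e, he, hdef⟩ := exists_enumeration_of_definable (M := M)
    have hall : ∀ x, x ∈ ordinalRange e := by
      by_contra! h
      obtain ⟨x, hx, hmin⟩ := exists_minimal_notMem_ordinalRange he h
      by_cases hiso : ∃ θ : LSet.Formula (Fin 1), (∃ y : Fin 1 → M, θ.Realize y) ∧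
          ∀ φ : LSet.Formula (Fin 1), (φ.Realize fun _ => x) →
            ∀ y : Fin 1 → M, θ.Realize y → φ.Realize y
      · obtain ⟨θ, hsat, hθ⟩ := hiso
        exact hx (hdef x (isDefinableElement_iff_dfn.1
          (isDefinableElement_of_isolated he hM hmin hsat hθ)))
      · push Not at hiso
        obtain ⟨N, _, hMN, homit⟩ := exists_elementarilyEquivalent_omitting (L := LSet) (M := M)
          -- Index 0 keeps the ordinals definable; all later indices repeat the type of `x`.
          (fun k => Nat.casesOn k undefinableOrdinalType fun _ => {φ | φ.Realize fun _ => x}) (by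
            rintro (_ | k) θ hθ
            · exact undefinableOrdinalType_not_isolated θ hθ
            · exact hiso θ hθ)
        have : N ⊨ T := hMN.theory_model
        have : Nonempty N := hMN.nonempty
        obtain ⟨g⟩ := hunique (Theory.ModelType.of T N) fun y hy =>
          isDefinableElement_of_omits hy (homit 0 fun _ => y)
        -- The isomorphism that uniqueness provides would carry `x` to a realization of its omitted
        -- type.
        obtain ⟨φ, hφ, hφy⟩ := homit 1 fun _ => g.symm x
        exact hφy ((StrongHomClass.realize_formula g.symm φ (v := fun _ => x)).2 hφ)
    refine ⟨M, fun x => ⟨{x}, ?_, Set.finite_singleton x, rfl⟩⟩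
    exact isDefinableElement_of_mem_ordinalRange he hM (hall x)

end AlgSet

theorem corollary4 (T : AlgSet.LSet.Theory) (hcomplete : T.IsComplete)
    (hZF : AlgSet.ExtendsZF T) :
    (∃ M : FirstOrder.Language.Theory.ModelType.{0, 0, u} T, AlgSet.PointwiseAlgebraic M) ↔
      ∃ M : FirstOrder.Language.Theory.ModelType.{0, 0, u} T, AlgSet.OrdinalsDefinable M ∧
        ∀ N : FirstOrder.Language.Theory.ModelType.{0, 0, u} T, AlgSet.OrdinalsDefinable N →
          Nonempty (N ≃[AlgSet.LSet] M) :=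
  AlgSet.exists_pointwiseAlgebraic_iff T hcomplete hZF
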